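/- Let $\mathcal G$ be a connected undirected graph on $n$ nodes and let $W=[w_{ij}]\in\mathbb R^{n\times n}$ satisfy: $w_{ij}=0$ if $i\ne j$ and $\{i,j\}$ is not an edge, and $w_{ij}>0$ otherwise; $W=W^T$; $\mathrm{null}(I-W)=\mathrm{span}\{\mathbf 1\}$; $I\succeq W\succ -I$. Let $\lambda_n(W)$ be the smallest eigenvalue of $W$. For $i=1,\dots,n$ let $f_i:\mathbb R^p\to\mathbb R$ be differentiable with $L_{f_i}$-Lipschitz gradient, $L_{f_i}>0$, let $r_i:\mathbb R^p\to\mathbb R\cup\{+\infty\}$, and let each $f_i+r_i$ be proper, lower semicontinuous and coercive (i.e. it tends to $+\infty$ as $\|u\|\to\infty$). Put $L_f=\max_i L_{f_i}$. For $\mathbf x\in\mathbb R^{n\times p}$ with rows $\mathbf x_{(i)}$ put $r(\mathbf x)=\sum_i r_i(\mathbf x_{(i)})$, let $\nabla\mathbf f(\mathbf x)$ be the matrix with rows $\nabla f_i(\mathbf x_{(i)})^T$, and put $$\hat{\mathcal L}_\alpha(\mathbf x)=\sum_{i=1}^n f_i(\mathbf x_{(i)})+\frac1{2\alpha}\langle\mathbf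 x,(I-W)\mathbf x\rangle+r(\mathbf x),$$ with $\langle\cdot,\cdot\rangle$ and $\|\cdot\|$ the Frobenius inner product and norm. Let the step size satisfy $0<\alpha<\frac{1+\lambda_n(W)}{L_f}$ if all $r_i$ are convex, and $\lambda_n(W)>0$ and $0<\alpha<\frac{\lambda_n(W)}{L_f}$ if the $r_i$ are not necessarily convex. Let $\{\mathbf x^k\}_{k\ge0}$ be generated by Prox-DGD from an arbitrary $\mathbf x^0$, that is, for all $k\ge 0$, $$\mathbf x^{k+1}\in\operatorname*{argmin}_{\mathbf u\in\mathbb R^{n\times p}}\Big\{\alpha r(\mathbf u)+\tfrac12\big\|\mathbf u-\big(W\mathbf x^k-\alpha\nabla\mathbf f(\mathbf x^k)\big)\big\|^2\Big\}.$$ Let $\mathbf x^*$ be an accumulation point of $\{\mathbf x^k\}$, and suppose that $\hat{\mathcal L}_\alpha$ satisfies the Kurdyka–Łojasiewicz inequality at $\mathbf x^*$ with $\psi(s)=c_1s^{1-\theta}$ for some constant $c_1>0$: $\partial\hat{\mathcal L}_\alpha(\mathbf x^*)\neq\emptyset$, where $\partial$ is the limiting subdifferential, and there are $\eta\in(0,+\infty]$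 and a neighbourhood $U$ of $\mathbf x^*$ such that $\psi$ is continuous, concave and nonnegative on $[0,\eta)$ with $\psi(0)=0$, $\psi$ is differentiable with $\psi'>0$ on $(0,\eta)$, and $$\psi'\big(\hat{\mathcal L}_\alpha(\mathbf x)-\hat{\mathcal L}_\alpha(\mathbf x^*)\big)\cdot\mathrm{dist}\big(0,\partial\hat{\mathcal L}_\alpha(\mathbf x)\big)\ge1$$ for all $\mathbf x\in U$ with $\hat{\mathcal L}_\alpha(\mathbf x^*)<\hat{\mathcal L}_\alpha(\mathbf x)<\hat{\mathcal L}_\alpha(\mathbf x^*)+\eta$. Then: (a) if $\theta=0$, $\mathbf x^k$ converges to $\mathbf x^*$ in finitely many iterations, i.e. $\mathbf x^k=\mathbf x^*$ for all sufficiently large $k$; (b) if $\theta\in(0,\frac12]$, there are $k^*>0$, $C_1>0$ and $\tau\in[0,1)$ with $\|\mathbf x^k-\mathbf x^*\|\le C_1\tau^k$ for all $k\ge k^*$; (c) if $\theta\in(\frac12,1)$, there are $k^*>0$ and $C_1>0$ with $\|\mathbf x^k-\mathbf x^*\|\le C_1k^{-(1-\theta)/(2\theta-1)}$ for all $k\ge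 k^*$. -/

import Mathlib

open Filter Topology

noncomputable section

namespace ProxDGD

section Variational

variable {E : Type*} [NormedAddCommGroup E] [InnerProductSpace ℝ E]

/-- Properness of an extended-real-valued function: never `-∞`, and not identically `+∞`. -/
def IsProper (h : E → EReal) : Prop :=
  (∀ x, h x ≠ ⊥) ∧ ∃ x, h x ≠ ⊤

/-- Coercivity: `h u → +∞` as `‖u‖ → +∞`. -/
def IsCoercive (h : E → EReal) : Prop :=
  Tendsto h (comap (fun u : E => ‖u‖) atTop) (𝓝 ⊤)

/-- Convexity of a function with values in `ℝ ∪ {+∞}`. -/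
def IsConvexFun (h : E → EReal) : Prop :=
  ∀ x y : E, ∀ a b : ℝ, 0 < a → 0 < b → a + b = 1 →
    h (a • x + b • y) ≤ (a : EReal) * h x + (b : EReal) * h y

/-- Fréchet (regular) subdifferential: `v` such that
`h y ≥ h x + ⟪v, y - x⟫ - o(‖y - x‖)` as `y → x`; empty where `h` is not finite. -/
def frechetSubdiff (h : E → EReal) (x : E) : Set E :=
  {v | h x ≠ ⊤ ∧ h x ≠ ⊥ ∧ ∀ ε : ℝ, 0 < ε → ∀ᶠ y in 𝓝 x,
    h x + ((inner ℝ v (y - x) - ε * ‖y - x‖ : ℝ) : EReal) ≤ h y}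

/-- Limiting (Mordukhovich) subdifferential: limits of Fréchet subgradients at points `u k → x`
with `h (u k) → h x`; empty where `h` is not finite. -/
def limitingSubdiff (h : E → EReal) (x : E) : Set E :=
  {v | h x ≠ ⊤ ∧ h x ≠ ⊥ ∧ ∃ u w : ℕ → E,
    Tendsto u atTop (𝓝 x) ∧ Tendsto (fun k => h (u k)) atTop (𝓝 (h x)) ∧
    (∀ k, w k ∈ frechetSubdiff h (u k)) ∧ Tendsto w atTop (𝓝 v)}

/-- `h` has the Kurdyka–Łojasiewicz property at `xs ∈ dom ∂h` with desingularizing function `φ`: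
for some `η ∈ (0, +∞]` and some neighbourhood `U` of `xs`, `φ` is continuous, concave and
nonnegative on `[0, η)`, `φ 0 = 0`, `φ` is differentiable with positive derivative on `(0, η)`, and
`φ' (h x - h xs) * dist (0, ∂h x) ≥ 1` for all `x ∈ U` with `h xs < h x < h xs + η`.
The distance to the empty set is `+∞`. -/
def HasKLPropertyWith (h : E → EReal) (xs : E) (φ : ℝ → ℝ) : Prop :=
  (limitingSubdiff h xs).Nonempty ∧
  ∃ η : EReal, 0 < η ∧ ∃ U ∈ 𝓝 xs,
    ContinuousOn φ {s : ℝ | 0 ≤ s ∧ (s : EReal) < η} ∧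
    ConcaveOn ℝ {s : ℝ | 0 ≤ s ∧ (s : EReal) < η} φ ∧
    (∀ s : ℝ, 0 ≤ s → (s : EReal) < η → 0 ≤ φ s) ∧
    φ 0 = 0 ∧
    (∀ s : ℝ, 0 < s → (s : EReal) < η → DifferentiableAt ℝ φ s ∧ 0 < deriv φ s) ∧
    ∀ x ∈ U, h xs < h x → h x < h xs + η →
      1 ≤ ENNReal.ofReal (deriv φ (h x - h xs).toReal) *
        Metric.infEDist (0 : E) (limitingSubdiff h x)

/-- `y ∈ prox_{α r} z`: `y` is a global minimizer of `u ↦ α r u + ‖u - z‖² / 2`. -/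
def IsProx (α : ℝ) (r : E → EReal) (z y : E) : Prop :=
  ∀ u : E, (α : EReal) * r y + ((‖y - z‖ ^ 2 / 2 : ℝ) : EReal) ≤
    (α : EReal) * r u + ((‖u - z‖ ^ 2 / 2 : ℝ) : EReal)

end Variational

/-- The local variable space `ℝ^p` with the Euclidean norm. -/
abbrev Loc (p : ℕ) : Type := EuclideanSpace ℝ (Fin p)

/-- `ℝ^{n × p}` with the Frobenius norm; `x i` is the row belonging to agent `i`. -/
abbrev Stacked (n p : ℕ) : Type := PiLp 2 (fun _ : Fin n => Loc p)

variable {n p : ℕ}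

/-- The matrix product `A x` for `A ∈ ℝ^{n × n}` and `x ∈ ℝ^{n × p}`. -/
def mix (A : Matrix (Fin n) (Fin n) ℝ) (x : Stacked n p) : Stacked n p :=
  WithLp.toLp 2 (fun i => ∑ j, A i j • x j)

/-- The smallest eigenvalue of a (symmetric) real matrix. -/
def lambdaMin (W : Matrix (Fin n) (Fin n) ℝ) : ℝ :=
  sInf (spectrum ℝ W)

/-- `W` is a mixing matrix for the communication graph `G`. -/
structure IsMixingMatrix (G : SimpleGraph (Fin n)) (W : Matrix (Fin n) (Fin n) ℝ) : Prop where
  zero_of_not_adj : ∀ i j, i ≠ j → ¬ G.Adj i j → W i j = 0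
  pos_of_eq_or_adj : ∀ i j, i = j ∨ G.Adj i j → 0 < W i j
  symm : W.transpose = W
  null_space : LinearMap.ker (1 - W).mulVecLin = Submodule.span ℝ {fun _ : Fin n => (1 : ℝ)}
  le_one : (1 - W).PosSemidef
  neg_one_lt : (W + 1).PosDef

/-- The composite objective assumption: each `f i` is differentiable with `L i`-Lipschitz gradient,
`L i > 0`; each `r i` takes values in `ℝ ∪ {+∞}`; and each `f i + r i` is proper, lower
semicontinuous and coercive. -/
structure CompositeObjective (f : Fin n → Loc p → ℝ) (r : Fin n → Loc p → EReal)
    (L : Fin n → ℝ) : Prop where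
  lip_pos : ∀ i, 0 < L i
  differentiable : ∀ i, Differentiable ℝ (f i)
  lipschitz : ∀ i u v, ‖gradient (f i) u - gradient (f i) v‖ ≤ L i * ‖u - v‖
  ne_bot : ∀ i u, r i u ≠ ⊥
  proper : ∀ i, IsProper (fun u => (f i u : EReal) + r i u)
  lsc : ∀ i, LowerSemicontinuous (fun u => (f i u : EReal) + r i u)
  coercive : ∀ i, IsCoercive (fun u => (f i u : EReal) + r i u)

/-- `L_f = max_i L_i`. -/
def maxLip (L : Fin n → ℝ) : ℝ := ⨆ i, L i

/-- `r(x) = ∑ i, r i (x i)`. -/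
def sumReg (r : Fin n → Loc p → EReal) (x : Stacked n p) : EReal := ∑ i, r i (x i)

/-- `∇f(x)`, whose `i`-th row is `∇f_i (x i)`. -/
def stackedGrad (f : Fin n → Loc p → ℝ) (x : Stacked n p) : Stacked n p :=
  WithLp.toLp 2 (fun i => gradient (f i) (x i))

/-- `𝓛_α(x) = ∑ i, f i (x i) + ‖x‖²_{I - W} / (2 α)`, with `‖x‖²_{I - W} = ⟪x, (I - W) x⟫`. -/
def lyapunov (f : Fin n → Loc p → ℝ) (W : Matrix (Fin n) (Fin n) ℝ) (α : ℝ)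
    (x : Stacked n p) : ℝ :=
  (∑ i, f i (x i)) + 1 / (2 * α) * inner ℝ x (mix (1 - W) x)

/-- The Lyapunov function of Prox-DGD, `𝓛_α(x) + r(x)`. -/
def compositeLyapunov (f : Fin n → Loc p → ℝ) (r : Fin n → Loc p → EReal)
    (W : Matrix (Fin n) (Fin n) ℝ) (α : ℝ) (x : Stacked n p) : EReal :=
  (lyapunov f W α x : EReal) + sumReg r x

/-- `x` is a sequence generated by Prox-DGD with fixed step size `α`:
`x^{k+1} ∈ prox_{α r} (W x^k - α ∇f(x^k))`, from an arbitrary `x^0`. -/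
def IsProxDGD (f : Fin n → Loc p → ℝ) (r : Fin n → Loc p → EReal)
    (W : Matrix (Fin n) (Fin n) ℝ) (α : ℝ) (x : ℕ → Stacked n p) : Prop :=
  ∀ k, IsProx α (sumReg r) (mix W (x k) - α • stackedGrad f (x k)) (x (k + 1))

/-- The step-size condition: `0 < α < (1 + λ_n(W)) / L_f` if all `r i` are convex; in general
`λ_n(W) > 0` and `0 < α < λ_n(W) / L_f`. -/
def StepSizeCondition (r : Fin n → Loc p → EReal) (W : Matrix (Fin n) (Fin n) ℝ)
    (L : Fin n → ℝ) (α : ℝ) : Prop :=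
  0 < α ∧
    (((∀ i, IsConvexFun (r i)) ∧ α < (1 + lambdaMin W) / maxLip L) ∨
      (0 < lambdaMin W ∧ α < lambdaMin W / maxLip L))

end ProxDGD

end

noncomputable section

namespace ProxDGD

/-! ### Real inequalities and abstract descent sequences under a Łojasiewicz inequality -/

section KLSequences

/-! Prox-DGD is the proximal gradient method with step `α` for `F + R`, where `F = lyapunov f W α`
and `R = sumReg r`: since `∇F = ∇f + α⁻¹(I - W)x`, one has `x - α∇F(x) = Wx - α∇f(x)`
(`sub_smul_lyapunovGrad`). The theorem is then an instance of `proximalGradient_rates`.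

Let `h k` be the gap between the objective at `x k` and at the cluster point. Two estimates drive
the argument. Sufficient decrease, `h (k+1) + a‖x (k+1) - x k‖² ≤ h k`, comes from
`lyapunov_sufficient_decrease`; a convex regularizer strengthens the proximal inequality, which is
why the step bound grows from `λ_n` to `1 + λ_n`. First-order optimality gives a subgradient at `x
(k+1)` of size `O(‖x (k+1) - x k‖)`, so the KL inequality becomes `h (k+1) ^ θ ≤ κ‖x (k+1) - x k‖`.

Concavity of `s ^ (1 - θ)` combines the two into a telescoping bound on the steps
(`norm_sub_le_of_lojasiewicz`): the iterates stay near the cluster point, and their distance to it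
is at most the last step plus a multiple of `h ^ (1 - θ)`. The rates follow from the scalar
recursion `h (k+1) + A h (k+1) ^ (2θ) ≤ h k` when `θ > 0`: geometric for `θ ≤ 1/2`, a power law
beyond. For `θ = 0` a positive gap would keep the steps away from zero. -/

theorem rpow_sub_rpow_ge_tangent {p s t : ℝ} (hp0 : 0 ≤ p) (hp1 : p ≤ 1) (hs : 0 < s)
    (ht : 0 ≤ t) : p * s ^ (p - 1) * (s - t) ≤ s ^ p - t ^ p := by
  -- Bernoulli's inequality for `(t / s) ^ p`, to be scaled by `s ^ p`; this form includes `t = 0`.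
  have hb := rpow_one_add_le_one_add_mul_self (s := t / s - 1)
    (by have := div_nonneg ht hs.le; linarith) hp0 hp1
  rw [add_sub_cancel, Real.div_rpow ht hs.le, div_le_iff₀ (Real.rpow_pos_of_pos hs p)] at hb
  have hsp : s ^ p = s ^ (p - 1) * s := by
    rw [← Real.rpow_add_one hs.ne']; ring_nf
  have : p * (t / s - 1) * s ^ p = p * s ^ (p - 1) * (t - s) := by
    rw [hsp]; field_simp
  nlinarith

/-- Discrete derivative of `u ^ (-s)`, from `log y ≤ y - 1` and `1 + y ≤ exp y`. The right side is
evaluated at `u + 1` because the recursion it serves is implicit; replacing `u` by `u + 1 ≤ 2u`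
costs `2 ^ (s + 1)`. -/
theorem rpow_neg_sub_le {s u : ℝ} (hs : 0 ≤ s) (hu : 1 ≤ u) :
    u ^ (-s) - (u + 1) ^ (-s) ≤ s * 2 ^ (s + 1) * (u + 1) ^ (-(s + 1)) := by
  have hu0 : 0 < u := by linarith
  have h1 : 1 - s / u ≤ (1 + 1 / u) ^ (-s) := by
    have hp : 0 < 1 + 1 / u := by positivity
    rw [Real.rpow_def_of_pos hp]
    have h2 := Real.add_one_le_exp (Real.log (1 + 1 / u) * -s)
    have h3 := Real.log_le_sub_one_of_pos hp
    have h4 : s * Real.log (1 + 1 / u) ≤ s * (1 / u) := by gcongr; linarith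
    have h5 : s * (1 / u) = s / u := by ring
    linarith
  have h6 : (u + 1) ^ (-s) = (1 + 1 / u) ^ (-s) * u ^ (-s) := by
    rw [← Real.mul_rpow (by positivity) hu0.le]
    congr 1; field_simp
  have h7 : u ^ (-s) - (u + 1) ^ (-s) ≤ s * u ^ (-(s + 1)) := by
    have h8 : u ^ (-s) = u ^ (-(s + 1)) * u := by
      rw [← Real.rpow_add_one hu0.ne']; ring_nf
    have h9 : (1 - s / u) * u ^ (-s) ≤ (u + 1) ^ (-s) := by
      rw [h6]; gcongr
    have h10 : s / u * u ^ (-s) = s * u ^ (-(s + 1)) := by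
      rw [h8]; field_simp
    linarith
  have h11 : u ^ (-(s + 1)) ≤ 2 ^ (s + 1) * (u + 1) ^ (-(s + 1)) := by
    have h12 : (2 * u) ^ (-(s + 1)) ≤ (u + 1) ^ (-(s + 1)) :=
      Real.rpow_le_rpow_of_nonpos (by linarith) (by linarith) (by linarith)
    rw [Real.mul_rpow (by norm_num) hu0.le] at h12
    calc u ^ (-(s + 1)) = 2 ^ (s + 1) * (2 ^ (-(s + 1)) * u ^ (-(s + 1))) := by
          rw [← mul_assoc, ← Real.rpow_add (by norm_num)]; simp
      _ ≤ _ := by gcongr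
  calc _ ≤ s * u ^ (-(s + 1)) := h7
    _ ≤ s * (2 ^ (s + 1) * (u + 1) ^ (-(s + 1))) := by gcongr
    _ = _ := by ring

/-- A sequence with `h (k + 1) + A * h (k + 1) ^ q ≤ h k`, `q > 1`, decays like
`k ^ (-1 / (q - 1))`. -/
theorem exists_le_rpow_of_add_rpow_le {h : ℕ → ℝ} {A q : ℝ} {N : ℕ} (hA : 0 < A) (hq : 1 < q)
    (hN : 1 ≤ N)
    (hrec : ∀ k ≥ N, h (k + 1) + A * h (k + 1) ^ q ≤ h k) :
    ∃ C : ℝ, 0 < C ∧ ∀ k ≥ N, h k ≤ C * (k : ℝ) ^ (-(1 / (q - 1))) := by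
  set s := 1 / (q - 1) with hsdef
  have hq1 : 0 < q - 1 := by linarith
  have hs : 0 < s := by positivity
  have hsq : s * q = s + 1 := by rw [hsdef]; field_simp; ring
  have hsq' : s * (q - 1) = 1 := by rw [hsdef]; field_simp
  set D := s * 2 ^ (s + 1) / A with hD
  have hDpos : 0 < D := by positivity
  have hNpos : (0 : ℝ) < N := by exact_mod_cast hN
  -- The first entry makes `A C ^ (q - 1)` dominate the constant of `rpow_neg_sub_le`; the second
  -- starts the induction at `N`.
  refine ⟨max (D ^ s) (h N * (N : ℝ) ^ s), lt_max_of_lt_left (by positivity), ?_⟩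
  set C := max (D ^ s) (h N * (N : ℝ) ^ s) with hC
  have hCpos : 0 < C := lt_max_of_lt_left (by positivity)
  have hCD : s * 2 ^ (s + 1) ≤ A * C ^ (q - 1) := by
    have h1 : D ≤ C ^ (q - 1) := by
      calc D = (D ^ s) ^ (q - 1) := by rw [← Real.rpow_mul hDpos.le, hsq', Real.rpow_one]
        _ ≤ _ := Real.rpow_le_rpow (by positivity) (le_max_left _ _) hq1.le
    rw [hD, div_le_iff₀ hA] at h1
    linarith
  intro k hk
  induction k, hk using Nat.le_induction with
  | base =>
    rw [Real.rpow_neg hNpos.le, ← div_eq_mul_inv, le_div_iff₀ (by positivity)]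
    exact le_max_right _ _
  | succ k hk ih =>
    -- If the bound failed at `k + 1`, the term `A * h (k + 1) ^ q` alone would be at least the drop
    -- `C(k ^ (-s) - (k + 1) ^ (-s))`, contradicting the recursion.
    by_contra! hlt
    have hk1 : (1 : ℝ) ≤ k := by exact_mod_cast hN.trans hk
    push_cast at hlt
    have hx : 0 < (k : ℝ) + 1 := by linarith
    have hpow : (C * ((k : ℝ) + 1) ^ (-s)) ^ q
        = C * C ^ (q - 1) * ((k : ℝ) + 1) ^ (-(s + 1)) := by
      rw [Real.mul_rpow hCpos.le (by positivity), ← Real.rpow_mul hx.le, neg_mul, hsq]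
      congr 1
      rw [mul_comm, ← Real.rpow_add_one hCpos.ne']; ring_nf
    have hmono : (C * ((k : ℝ) + 1) ^ (-s)) ^ q ≤ h (k + 1) ^ q :=
      Real.rpow_le_rpow (by positivity) hlt.le (by linarith)
    have h1 := hrec k hk
    have h2 := rpow_neg_sub_le hs.le hk1
    have h3 : C * ((k : ℝ) ^ (-s) - ((k : ℝ) + 1) ^ (-s))
        ≤ A * (C * ((k : ℝ) + 1) ^ (-s)) ^ q := by
      rw [hpow]
      calc _ ≤ C * (s * 2 ^ (s + 1) * ((k : ℝ) + 1) ^ (-(s + 1))) := by gcongr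
        _ ≤ C * (A * C ^ (q - 1) * ((k : ℝ) + 1) ^ (-(s + 1))) := by gcongr
        _ = _ := by ring
    have h4 : A * (C * ((k : ℝ) + 1) ^ (-s)) ^ q ≤ A * h (k + 1) ^ q := by gcongr
    linarith

variable {E : Type*} [NormedAddCommGroup E]

/-- A descent sequence satisfying a relative Łojasiewicz inequality near a cluster point stays near
it from some index on, and its distance to the cluster point is controlled by the last step and
the gap of the function values. -/
theorem norm_sub_le_of_lojasiewicz {x : ℕ → E} {xs : E} {h : ℕ → ℝ} {a κ θ ε e : ℝ}
    (ha : 0 < a) (hκ : 0 < κ) (hθ1 : θ < 1) (hθ0 : 0 ≤ θ) (hε : 0 < ε) (he : 0 < e)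
    (h0 : ∀ k ≥ 1, 0 ≤ h k) (hdesc : ∀ k ≥ 1, h (k + 1) + a * ‖x (k + 1) - x k‖ ^ 2 ≤ h k)
    (hh : Tendsto h atTop (𝓝 0)) (hd : Tendsto (fun k => ‖x (k + 1) - x k‖) atTop (𝓝 0))
    (hclus : MapClusterPt xs atTop x)
    (hKL : ∀ k ≥ 1, ‖x (k + 1) - xs‖ < ε → 0 < h (k + 1) → h (k + 1) < e →
      h (k + 1) ^ θ ≤ κ * ‖x (k + 1) - x k‖) :
    ∃ N ≥ 1, ∀ k ≥ N, ‖x (k + 1) - xs‖ < ε ∧ h (k + 1) < e ∧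
      ‖x (k + 1) - xs‖ ≤ ‖x (k + 1) - x k‖ + κ / (a * (1 - θ)) * h (k + 1) ^ (1 - θ) := by
  have hθ : 0 < 1 - θ := by linarith
  set B := κ / (a * (1 - θ)) with hB
  have hBpos : 0 < B := by positivity
  set V : ℕ → ℝ := fun k => ‖x (k + 1) - x k‖ + B * h (k + 1) ^ (1 - θ) with hV
  have hV0 : ∀ k, 0 ≤ V k := fun k => by
    have := Real.rpow_nonneg (h0 (k + 1) (by omega)) (1 - θ)
    positivity
  -- `V` is a potential whose drop pays for the next step, as long as the iterate is in the KL
  -- region.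
  have hstep : ∀ k ≥ 1, ‖x (k + 1) - xs‖ < ε → h (k + 1) < e →
      ‖x (k + 1 + 1) - x (k + 1)‖ + V (k + 1) ≤ V k := by
    intro k hk hxk hek
    have hdk := hdesc (k + 1) (by omega)
    have h1 := h0 (k + 1) (by omega)
    have h2 := h0 (k + 1 + 1) (by omega)
    rcases h1.eq_or_lt with hz | hpos
    · have hz2 : h (k + 1 + 1) = 0 := by
        have : 0 ≤ a * ‖x (k + 1 + 1) - x (k + 1)‖ ^ 2 := by positivity
        linarith
      have hz3 : ‖x (k + 1 + 1) - x (k + 1)‖ = 0 := by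
        have : a * ‖x (k + 1 + 1) - x (k + 1)‖ ^ 2 ≤ 0 := by linarith
        have : ‖x (k + 1 + 1) - x (k + 1)‖ ^ 2 ≤ 0 := by
          by_contra! hc
          have := mul_pos ha hc
          linarith
        nlinarith [norm_nonneg (x (k + 1 + 1) - x (k + 1))]
      have : V (k + 1) = 0 := by
        simp only [hV, hz3, hz2, Real.zero_rpow hθ.ne']; simp
      rw [this, hz3]; simpa using hV0 k
    · have hk1 := hKL k hk hxk hpos hek
      have ht := rpow_sub_rpow_ge_tangent (p := 1 - θ) (s := h (k + 1)) (t := h (k + 1 + 1))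
        hθ.le (by linarith) hpos h2
      rw [show 1 - θ - 1 = -θ by ring, Real.rpow_neg hpos.le] at ht
      have hq : 0 < h (k + 1) ^ θ := Real.rpow_pos_of_pos hpos θ
      set u := ‖x (k + 1) - x k‖ with hu
      set w := ‖x (k + 1 + 1) - x (k + 1)‖ with hw
      set P := h (k + 1) ^ (1 - θ) - h (k + 1 + 1) ^ (1 - θ) with hP
      have hu0 : 0 ≤ u := norm_nonneg _
      have hw0 : 0 ≤ w := norm_nonneg _
      have hPge : (1 - θ) * (a * w ^ 2) ≤ P * (κ * u) := by
        have h3 : (1 - θ) * (h (k + 1) ^ θ)⁻¹ * (a * w ^ 2) ≤ P :=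
          le_trans (by gcongr; linarith) ht
        have h4 : (1 - θ) * (a * w ^ 2) ≤ P * h (k + 1) ^ θ := by
          calc _ = (1 - θ) * (h (k + 1) ^ θ)⁻¹ * (a * w ^ 2) * h (k + 1) ^ θ := by field_simp
            _ ≤ _ := by gcongr
        have hP0 : 0 ≤ P := le_trans (by positivity) h3
        exact h4.trans (by gcongr)
      -- The constant `B` is chosen for exactly this form, so that AM-GM gives `2w ≤ u + B P`; one
      -- copy of `w` is absorbed into `V (k + 1)`.
      have h5 : w ^ 2 ≤ u * (B * P) := by
        have h6 : w ^ 2 = (1 - θ) * (a * w ^ 2) / (a * (1 - θ)) := by field_simp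
        have h7 : u * (B * P) = P * (κ * u) / (a * (1 - θ)) := by rw [hB]; field_simp
        rw [h6, h7]; gcongr
      have hBP : 0 ≤ u + B * P := by
        have : 0 ≤ P := by
          have : h (k + 1 + 1) ^ (1 - θ) ≤ h (k + 1) ^ (1 - θ) :=
            Real.rpow_le_rpow h2 (by nlinarith [mul_nonneg ha.le (sq_nonneg w)]) hθ.le
          linarith
        positivity
      have h6 : 2 * w ≤ u + B * P := by
        apply abs_le_of_sq_le_sq' _ hBP |>.2
        nlinarith [sq_nonneg (u - B * P)]
      change w + (w + B * h (k + 1 + 1) ^ (1 - θ)) ≤ u + B * h (k + 1) ^ (1 - θ)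
      have : B * P = B * h (k + 1) ^ (1 - θ) - B * h (k + 1 + 1) ^ (1 - θ) := by rw [hP]; ring
      linarith
  have hVlim : Tendsto V atTop (𝓝 0) := by
    have h1 : Tendsto (fun k => h (k + 1) ^ (1 - θ)) atTop (𝓝 0) := by
      have := ((tendsto_add_atTop_iff_nat 1).2 hh).rpow_const (p := 1 - θ) (Or.inr hθ.le)
      rwa [Real.zero_rpow hθ.ne'] at this
    simpa using hd.add (h1.const_mul B)
  have hfreq : ∀ δ > 0, ∃ᶠ k in atTop, ‖x (k + 1) - xs‖ < δ := by
    intro δ hδ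
    have h1 : ∃ᶠ k in atTop, ‖x k - xs‖ < δ := by
      have := hclus.frequently (Metric.ball_mem_nhds xs hδ)
      simpa [dist_eq_norm] using this
    rw [frequently_atTop] at h1 ⊢
    intro n
    obtain ⟨b, hb, hb2⟩ := h1 (n + 1)
    exact ⟨b - 1, by omega, by rwa [show b - 1 + 1 = b by omega]⟩
  -- Half of `ε` is for the distance at the starting index, half for the total length still to be
  -- travelled, which `V m` bounds.
  obtain ⟨m, hm1, hm2, hm3, hm4⟩ := ((hfreq (ε / 2) (by positivity)).and_eventually
    ((hVlim.eventually_lt_const (show 0 < ε / 2 by positivity)).and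
      ((((tendsto_add_atTop_iff_nat 1).2 hh).eventually_lt_const he).and
        (eventually_ge_atTop 1)))).exists
  have hanti : ∀ k ≥ 1, h (k + 1) ≤ h k := fun k hk => by
    have := hdesc k hk
    nlinarith [mul_nonneg ha.le (sq_nonneg ‖x (k + 1) - x k‖)]
  have hmain : ∀ k ≥ m, ‖x (k + 1) - xs‖ < ε ∧ h (k + 1) < e ∧
      ‖x (k + 1) - x (m + 1)‖ + V k ≤ V m := by
    intro k hk
    induction k, hk using Nat.le_induction with
    | base => exact ⟨by linarith, hm3, by simp⟩
    | succ k hk ih =>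
      obtain ⟨i1, i2, i3⟩ := ih
      have h1 := hstep k (by omega) i1 i2
      have h2 : ‖x (k + 1 + 1) - x (m + 1)‖
          ≤ ‖x (k + 1 + 1) - x (k + 1)‖ + ‖x (k + 1) - x (m + 1)‖ :=
        norm_sub_le_norm_sub_add_norm_sub _ _ _
      have h3 : ‖x (k + 1 + 1) - x (m + 1)‖ + V (k + 1) ≤ V m := by linarith
      refine ⟨?_, (hanti (k + 1) (by omega)).trans_lt i2, h3⟩
      have h4 : ‖x (k + 1 + 1) - xs‖ ≤ ‖x (k + 1 + 1) - x (m + 1)‖ + ‖x (m + 1) - xs‖ :=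
        norm_sub_le_norm_sub_add_norm_sub _ _ _
      have := hV0 (k + 1)
      linarith
  have htail : ∀ k ≥ m, ∀ l ≥ k, ‖x (l + 1) - x (k + 1)‖ + V l ≤ V k := by
    intro k hk l hl
    induction l, hl using Nat.le_induction with
    | base => simp
    | succ l hl ih =>
      have h1 := hstep l (by omega) (hmain l (by omega)).1 (hmain l (by omega)).2.1
      have h2 : ‖x (l + 1 + 1) - x (k + 1)‖
          ≤ ‖x (l + 1 + 1) - x (l + 1)‖ + ‖x (l + 1) - x (k + 1)‖ :=
        norm_sub_le_norm_sub_add_norm_sub _ _ _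
      linarith
  refine ⟨m, hm4, fun k hk => ⟨(hmain k hk).1, (hmain k hk).2.1, ?_⟩⟩
  change ‖x (k + 1) - xs‖ ≤ V k
  -- The tail bound is compared with later iterates that return within `δ` of `xs`; a cluster point
  -- suffices, convergence need not be known.
  refine le_of_forall_pos_le_add fun δ hδ => ?_
  obtain ⟨l, hl, hlk⟩ := ((hfreq δ hδ).and_eventually (eventually_ge_atTop k)).exists
  have h1 := htail k hk l hlk
  have h2 : ‖x (k + 1) - xs‖ ≤ ‖x (k + 1) - x (l + 1)‖ + ‖x (l + 1) - xs‖ :=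
    norm_sub_le_norm_sub_add_norm_sub _ _ _
  rw [norm_sub_rev (x (k + 1)) (x (l + 1))] at h2
  have := hV0 l
  linarith

end KLSequences

/-! ### Convergence rates from descent and the Łojasiewicz bound -/

section Rates

variable {E : Type*} [NormedAddCommGroup E] {x : ℕ → E} {xs : E} {h : ℕ → ℝ} {a κ B θ : ℝ} {N : ℕ}

/-- A positive gap forces `κ` times the step to be at least `1`, impossible once the steps are
small. With zero gaps, descent forces zero steps and the distance bound places the iterate at `xs`.
-/
theorem eventually_eq_of_lojasiewicz_zero (ha : 0 < a) (h0 : ∀ k ≥ N, 0 ≤ h k)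
    (hdesc : ∀ k ≥ N, h (k + 1) + a * ‖x (k + 1) - x k‖ ^ 2 ≤ h k)
    (hd : Tendsto (fun k => ‖x (k + 1) - x k‖) atTop (𝓝 0))
    (hKL : ∀ k ≥ N, 0 < h (k + 1) → 1 ≤ κ * ‖x (k + 1) - x k‖)
    (hdist : ∀ k ≥ N, ‖x (k + 1) - xs‖ ≤ ‖x (k + 1) - x k‖ + B * h (k + 1)) :
    ∃ K : ℕ, ∀ k ≥ K, x k = xs := by
  have h1 : ∀ᶠ k in atTop, κ * ‖x (k + 1) - x k‖ < 1 := by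
    have := hd.const_mul κ
    rw [mul_zero] at this
    exact this.eventually_lt_const one_pos
  obtain ⟨M, hM⟩ := eventually_atTop.1 h1
  have hz : ∀ k ≥ max M N, h (k + 1) = 0 := by
    intro k hk
    have hkM := le_of_max_le_left hk
    have hkN := le_of_max_le_right hk
    by_contra hne
    have := hKL k hkN (lt_of_le_of_ne (h0 (k + 1) (by omega)) (Ne.symm hne))
    exact absurd this (not_le.2 (hM k hkM))
  refine ⟨max M N + 2, fun k hk => ?_⟩
  obtain ⟨j, rfl⟩ : ∃ j, k = j + 1 + 1 := ⟨k - 2, by omega⟩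
  have hj : j ≥ max M N := by omega
  have hjN := le_of_max_le_right hj
  have h2 := hdesc (j + 1) (by omega)
  have h3 := hdist (j + 1) (by omega)
  rw [hz j hj, hz (j + 1) (by omega)] at h2
  rw [hz (j + 1) (by omega)] at h3
  have h4 : ‖x (j + 1 + 1) - x (j + 1)‖ ^ 2 ≤ 0 := by
    by_contra! hc
    have := mul_pos ha hc
    linarith
  have h5 : ‖x (j + 1 + 1) - x (j + 1)‖ = 0 := by
    nlinarith [norm_nonneg (x (j + 1 + 1) - x (j + 1))]
  rw [h5] at h3
  exact sub_eq_zero.1 (norm_le_zero_iff.1 (by linarith))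

theorem add_rpow_le_of_lojasiewicz (hκ : 0 < κ) (ha : 0 < a)
    {k : ℕ} (h0 : 0 ≤ h (k + 1))
    (hdesc : h (k + 1) + a * ‖x (k + 1) - x k‖ ^ 2 ≤ h k)
    (hKL : h (k + 1) ^ θ ≤ κ * ‖x (k + 1) - x k‖) :
    h (k + 1) + a / κ ^ 2 * h (k + 1) ^ (2 * θ) ≤ h k := by
  have h1 : h (k + 1) ^ (2 * θ) = (h (k + 1) ^ θ) ^ 2 := by
    rw [mul_comm, Real.rpow_mul h0]; norm_cast
  have h2 : (h (k + 1) ^ θ) ^ 2 ≤ (κ * ‖x (k + 1) - x k‖) ^ 2 :=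
    pow_le_pow_left₀ (Real.rpow_nonneg h0 θ) hKL 2
  have h3 : a / κ ^ 2 * h (k + 1) ^ (2 * θ) ≤ a * ‖x (k + 1) - x k‖ ^ 2 := by
    rw [h1]
    calc _ ≤ a / κ ^ 2 * (κ * ‖x (k + 1) - x k‖) ^ 2 := by gcongr
      _ = _ := by field_simp
  linarith

theorem norm_step_le_sqrt (ha : 0 < a) {k : ℕ} (h0 : 0 ≤ h (k + 1))
    (hdesc : h (k + 1) + a * ‖x (k + 1) - x k‖ ^ 2 ≤ h k) :
    ‖x (k + 1) - x k‖ ≤ (√a)⁻¹ * √(h k) := by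
  rw [inv_mul_eq_div, ← Real.sqrt_div' _ ha.le]
  apply Real.le_sqrt_of_sq_le
  rw [le_div_iff₀ ha]
  linarith

theorem linear_rate_of_lojasiewicz (ha : 0 < a) (hκ : 0 < κ) (hB : 0 ≤ B) (hθ : θ ≤ 1 / 2)
    (h0 : ∀ k ≥ N, 0 ≤ h k) (h1 : ∀ k ≥ N, h k ≤ 1)
    (hdesc : ∀ k ≥ N, h (k + 1) + a * ‖x (k + 1) - x k‖ ^ 2 ≤ h k)
    (hKL : ∀ k ≥ N, h (k + 1) ^ θ ≤ κ * ‖x (k + 1) - x k‖)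
    (hdist : ∀ k ≥ N, ‖x (k + 1) - xs‖ ≤ ‖x (k + 1) - x k‖ + B * h (k + 1) ^ (1 - θ)) :
    ∃ (K : ℕ) (C τ : ℝ), 0 < K ∧ 0 < C ∧ 0 ≤ τ ∧ τ < 1 ∧ ∀ k ≥ K, ‖x k - xs‖ ≤ C * τ ^ k := by
  set q := (1 + a / κ ^ 2)⁻¹ with hq
  have hA : 0 < a / κ ^ 2 := by positivity
  have hqpos : 0 < q := by positivity
  have hq1 : q < 1 := inv_lt_one_of_one_lt₀ (by linarith)
  have hanti : ∀ k ≥ N, h (k + 1) ≤ h k := fun k hk => by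
    have := hdesc k hk
    nlinarith [mul_nonneg ha.le (sq_nonneg ‖x (k + 1) - x k‖)]
  have hrec : ∀ k ≥ N, h (k + 1) ≤ q * h k := by
    intro k hk
    have hk0 := h0 (k + 1) (by omega)
    have h2 := add_rpow_le_of_lojasiewicz hκ ha hk0 (hdesc k hk) (hKL k hk)
    -- Here `h ≤ 1` and `2θ ≤ 1` reduce the recursion to a linear contraction with factor `q`.
    have h3 : h (k + 1) ≤ h (k + 1) ^ (2 * θ) := by
      rcases hk0.eq_or_lt with hz | hp
      · rw [← hz]; exact Real.rpow_nonneg le_rfl _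
      · simpa using Real.rpow_le_rpow_of_exponent_ge hp (h1 (k + 1) (by omega))
          (show 2 * θ ≤ 1 by linarith)
    rw [hq, inv_mul_eq_div, le_div_iff₀ (by positivity)]
    have := mul_le_mul_of_nonneg_left h3 hA.le
    linarith
  have hgeo : ∀ j, h (N + j) ≤ q ^ j * h N := by
    intro j
    induction j with
    | zero => simp
    | succ j ih =>
      calc h (N + j + 1) ≤ q * h (N + j) := hrec _ (by omega)
        _ ≤ q * (q ^ j * h N) := by gcongr
        _ = _ := by ring
  have hgeo' : ∀ j, √(h (N + j)) ≤ √q ^ j := by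
    intro j
    have : √q ^ j = √(q ^ j) := by
      rw [Real.sqrt_eq_rpow, Real.sqrt_eq_rpow, ← Real.rpow_natCast, ← Real.rpow_natCast,
        ← Real.rpow_mul hqpos.le, ← Real.rpow_mul hqpos.le, mul_comm]
    rw [this]
    apply Real.sqrt_le_sqrt
    calc _ ≤ q ^ j * h N := hgeo j
      _ ≤ q ^ j * 1 := by gcongr; exact h1 N le_rfl
      _ = _ := mul_one _
  have hτ : 0 < √q := Real.sqrt_pos.2 hqpos
  have ha' : 0 < √a := Real.sqrt_pos.2 ha
  -- Distances decay like the square root of the gap, hence the ratio `√q`; the inverse power undoes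
  -- the index shift by `N + 1`.
  refine ⟨N + 1, ((√a)⁻¹ + B) * (√q ^ (N + 1))⁻¹, √q, by omega, by positivity, hτ.le,
    by rw [Real.sqrt_lt' one_pos]; simpa using hq1, fun k hk => ?_⟩
  obtain ⟨j, rfl⟩ : ∃ j, k = N + j + 1 := ⟨k - (N + 1), by omega⟩
  have hk0 := h0 (N + j + 1) (by omega)
  have h4 : h (N + j + 1) ^ (1 - θ) ≤ √(h (N + j)) := by
    rcases hk0.eq_or_lt with hz | hp
    · rw [← hz, Real.zero_rpow (by linarith)]; positivity
    · calc _ ≤ h (N + j + 1) ^ (1 / 2 : ℝ) :=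
          Real.rpow_le_rpow_of_exponent_ge hp (h1 _ (by omega)) (by linarith)
        _ = √(h (N + j + 1)) := (Real.sqrt_eq_rpow _).symm
        _ ≤ _ := Real.sqrt_le_sqrt (hanti _ (by omega))
  calc ‖x (N + j + 1) - xs‖ ≤ _ := hdist (N + j) (by omega)
    _ ≤ (√a)⁻¹ * √(h (N + j)) + B * √(h (N + j)) := by
        gcongr
        exact norm_step_le_sqrt ha hk0 (hdesc _ (by omega))
    _ = ((√a)⁻¹ + B) * √(h (N + j)) := by ring
    _ ≤ ((√a)⁻¹ + B) * √q ^ j := by gcongr; exact hgeo' j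
    _ = ((√a)⁻¹ + B) * (√q ^ (N + 1))⁻¹ * √q ^ (N + j + 1) := by
        rw [show N + j + 1 = (N + 1) + j by ring, pow_add _ (N + 1)]
        field_simp

theorem sublinear_rate_of_lojasiewicz (ha : 0 < a) (hκ : 0 < κ) (hB : 0 ≤ B) (hθ : 1 / 2 < θ)
    (hθ1 : θ < 1) (hN : 1 ≤ N)
    (h0 : ∀ k ≥ N, 0 ≤ h k) (h1 : ∀ k ≥ N, h k ≤ 1)
    (hdesc : ∀ k ≥ N, h (k + 1) + a * ‖x (k + 1) - x k‖ ^ 2 ≤ h k)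
    (hKL : ∀ k ≥ N, h (k + 1) ^ θ ≤ κ * ‖x (k + 1) - x k‖)
    (hdist : ∀ k ≥ N, ‖x (k + 1) - xs‖ ≤ ‖x (k + 1) - x k‖ + B * h (k + 1) ^ (1 - θ)) :
    ∃ (K : ℕ) (C : ℝ), 0 < K ∧ 0 < C ∧
      ∀ k ≥ K, ‖x k - xs‖ ≤ C * (k : ℝ) ^ (-(1 - θ) / (2 * θ - 1)) := by
  have hanti : ∀ k ≥ N, h (k + 1) ≤ h k := fun k hk => by
    have := hdesc k hk
    nlinarith [mul_nonneg ha.le (sq_nonneg ‖x (k + 1) - x k‖)]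
  obtain ⟨C, hC, hrate⟩ := exists_le_rpow_of_add_rpow_le (h := h) (A := a / κ ^ 2) (q := 2 * θ)
    (by positivity) (by linarith) hN
    (fun k hk => add_rpow_le_of_lojasiewicz hκ ha (h0 _ (by omega)) (hdesc k hk) (hKL k hk))
  have ha' : 0 < √a := Real.sqrt_pos.2 ha
  have hq : 0 < 2 * θ - 1 := by linarith
  set t := (1 - θ) / (2 * θ - 1) with ht
  have ht0 : 0 < t := div_pos (by linarith) hq
  have htt : -(1 - θ) / (2 * θ - 1) = -t := by rw [ht]; ring
  rw [htt]
  refine ⟨N + 1, ((√a)⁻¹ + B) * C ^ (1 - θ) * 2 ^ t, by omega, by positivity, fun k hk => ?_⟩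
  obtain ⟨k, rfl⟩ : ∃ j, k = j + 1 := ⟨k - 1, by omega⟩
  have hkN : k ≥ N := by omega
  have hk0 := h0 k hkN
  have hk0' := h0 (k + 1) (by omega)
  have hkpos : (1 : ℝ) ≤ k := by exact_mod_cast hN.trans hkN
  -- For `θ > 1/2` the exponent `1 - θ` is below `1/2`, so this power, not the step length, governs
  -- the rate.
  have h4 : √(h k) ≤ h k ^ (1 - θ) := by
    rcases hk0.eq_or_lt with hz | hp
    · rw [← hz]; simpa using Real.rpow_nonneg le_rfl _
    · rw [Real.sqrt_eq_rpow]
      exact Real.rpow_le_rpow_of_exponent_ge hp (h1 _ hkN) (by linarith)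
  have h5 : h k ^ (1 - θ) ≤ C ^ (1 - θ) * (k : ℝ) ^ (-t) := by
    calc _ ≤ (C * (k : ℝ) ^ (-(1 / (2 * θ - 1)))) ^ (1 - θ) :=
          Real.rpow_le_rpow hk0 (hrate k hkN) (by linarith)
      _ = _ := by
        rw [Real.mul_rpow hC.le (by positivity), ← Real.rpow_mul (by positivity)]
        congr 2; rw [ht]; ring
  have h6 : (k : ℝ) ^ (-t) ≤ 2 ^ t * ((k + 1 : ℕ) : ℝ) ^ (-t) := by
    push_cast
    have h7 : (2 * (k : ℝ)) ^ (-t) ≤ ((k : ℝ) + 1) ^ (-t) :=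
      Real.rpow_le_rpow_of_nonpos (by linarith) (by linarith) (by linarith)
    rw [Real.mul_rpow (by norm_num) (by linarith)] at h7
    calc (k : ℝ) ^ (-t) = 2 ^ t * (2 ^ (-t) * (k : ℝ) ^ (-t)) := by
          rw [← mul_assoc, ← Real.rpow_add (by norm_num)]; simp
      _ ≤ _ := by gcongr
  calc ‖x (k + 1) - xs‖ ≤ _ := hdist k hkN
    _ ≤ (√a)⁻¹ * √(h k) + B * h k ^ (1 - θ) := by
        gcongr
        · exact norm_step_le_sqrt ha hk0' (hdesc _ hkN)
        · exact hanti k hkN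
    _ ≤ (√a)⁻¹ * h k ^ (1 - θ) + B * h k ^ (1 - θ) := by gcongr
    _ = ((√a)⁻¹ + B) * h k ^ (1 - θ) := by ring
    _ ≤ ((√a)⁻¹ + B) * (C ^ (1 - θ) * (2 ^ t * ((k + 1 : ℕ) : ℝ) ^ (-t))) := by
        gcongr; exact h5.trans (by gcongr)
    _ = _ := by ring

end Rates

/-! ### Proximal gradient sequences for a smooth plus an extended-valued function -/

section ProximalGradient

section

variable {E : Type*} [NormedAddCommGroup E]

theorem IsProx.real_le {α ρ σ : ℝ} {R : E → EReal} {z y u : E} (h : IsProx α R z y)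
    (hy : R y = ρ) (hu : R u = σ) : α * ρ + ‖y - z‖ ^ 2 / 2 ≤ α * σ + ‖u - z‖ ^ 2 / 2 := by
  have := h u
  rw [hy, hu] at this
  exact_mod_cast this

/-- Comparison with a point of finite value. It makes every iterate after the initial one finite,
which is why the gap estimates start at index `1`. -/
theorem IsProx.ne_top {α : ℝ} {R : E → EReal} {z y : E} (h : IsProx α R z y) (hα : 0 < α)
    (hbot : ∀ u, R u ≠ ⊥) (hR : ∃ u, R u ≠ ⊤) : R y ≠ ⊤ := by
  obtain ⟨u, hu⟩ := hR
  intro hy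
  have := h u
  lift R u to ℝ using ⟨hu, hbot u⟩ with σ
  rw [hy, EReal.coe_mul_top_of_pos hα, EReal.top_add_coe, top_le_iff] at this
  exact EReal.coe_ne_top (α * σ + ‖u - z‖ ^ 2 / 2) (by exact_mod_cast this)

end

variable {E : Type*} [NormedAddCommGroup E] [InnerProductSpace ℝ E]

theorem norm_sub_sq_sub_norm_sub_sq (y u z : E) :
    ‖u - z‖ ^ 2 = ‖y - z‖ ^ 2 + 2 * inner ℝ (y - z) (u - y) + ‖u - y‖ ^ 2 := by
  rw [← norm_add_sq_real, sub_add_sub_cancel']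

/-- First-order optimality of a proximal gradient step. -/
theorem mem_frechetSubdiff_of_isProx {α M : ℝ} {F : E → ℝ} {R : E → EReal} {g : E → E} {x y : E}
    (hα : 0 < α) (hM : 0 ≤ M) (hF : ∀ u, F y + inner ℝ (g y) (u - y) - M * ‖u - y‖ ^ 2 ≤ F u)
    (hbot : ∀ u, R u ≠ ⊥) (hy : R y ≠ ⊤) (h : IsProx α R (x - α • g x) y) :
    g y - g x - α⁻¹ • (y - x) ∈ frechetSubdiff (fun u => (F u : EReal) + R u) y := by
  obtain ⟨ρ, hρ⟩ : ∃ ρ : ℝ, R y = ρ := ⟨_, (EReal.coe_toReal hy (hbot y)).symm⟩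
  have hHy : (F y : EReal) + R y = ((F y + ρ : ℝ) : EReal) := by rw [hρ]; norm_cast
  refine ⟨hHy.trans_ne (EReal.coe_ne_top _), hHy.trans_ne (EReal.coe_ne_bot _), ?_⟩
  intro ε hε
  beta_reduce
  -- `M` is the curvature error of `F`, and `1 / (2α)` that of the proximal term; on the ball of
  -- radius `ε / K` their sum is absorbed by `ε‖u - y‖`.
  set K := M + 1 / (2 * α) with hK
  have hKpos : 0 < K := by positivity
  filter_upwards [Metric.ball_mem_nhds y (div_pos hε hKpos)] with u hu
  rw [mem_ball_iff_norm, lt_div_iff₀ hKpos] at hu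
  rw [hHy]
  by_cases hut : R u = ⊤
  · rw [hut, EReal.coe_add_top]; exact le_top
  obtain ⟨σ, hσ⟩ : ∃ σ : ℝ, R u = σ := ⟨_, (EReal.coe_toReal hut (hbot u)).symm⟩
  rw [hσ]
  norm_cast
  have h1 := h.real_le hρ hσ
  rw [norm_sub_sq_sub_norm_sub_sq y u] at h1
  have h2 := hF u
  have h3 : inner ℝ (g y - g x - α⁻¹ • (y - x)) (u - y)
      = inner ℝ (g y) (u - y) - α⁻¹ * inner ℝ (y - (x - α • g x)) (u - y) := by
    rw [← real_inner_smul_left, ← inner_sub_left]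
    congr 1
    rw [sub_sub_eq_add_sub, add_sub_right_comm, smul_add, smul_smul, inv_mul_cancel₀ hα.ne']
    module
  have h4 : ρ - α⁻¹ * inner ℝ (y - (x - α • g x)) (u - y) - 1 / (2 * α) * ‖u - y‖ ^ 2 ≤ σ := by
    have h5 : α * (ρ - α⁻¹ * inner ℝ (y - (x - α • g x)) (u - y) - 1 / (2 * α) * ‖u - y‖ ^ 2)
        ≤ α * σ := by
      have : α * (ρ - α⁻¹ * inner ℝ (y - (x - α • g x)) (u - y) - 1 / (2 * α) * ‖u - y‖ ^ 2)
        = α * ρ - inner ℝ (y - (x - α • g x)) (u - y) - ‖u - y‖ ^ 2 / 2 := by field_simp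
      rw [this]; linarith
    exact le_of_mul_le_mul_left h5 hα
  have h6 : K * ‖u - y‖ ^ 2 ≤ ε * ‖u - y‖ := by nlinarith [norm_nonneg (u - y)]
  rw [hK, add_mul] at h6
  rw [h3]
  linarith

theorem frechetSubdiff_subset_limitingSubdiff (h : E → EReal) (x : E) :
    frechetSubdiff h x ⊆ limitingSubdiff h x := fun v hv =>
  ⟨hv.1, hv.2.1, fun _ => x, fun _ => v, tendsto_const_nhds, tendsto_const_nhds, fun _ => hv,
    tendsto_const_nhds⟩

/-- The real-valued form of the Kurdyka-Łojasiewicz inequality with `φ s = c * s ^ (1 - θ)`. -/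
theorem HasKLPropertyWith.rpow_le {H : E → EReal} {xs : E} {c θ Hs : ℝ}
    (hKL : HasKLPropertyWith H xs (fun s : ℝ => c * s ^ (1 - θ))) (hHs : H xs = Hs) :
    ∃ ε > 0, ∃ e > 0, e ≤ 1 ∧ ∀ (y v : E) (Hy : ℝ), ‖y - xs‖ < ε → H y = Hy →
      v ∈ limitingSubdiff H y → 0 < Hy - Hs → Hy - Hs < e →
      (Hy - Hs) ^ θ ≤ c * (1 - θ) * ‖v‖ := by
  obtain ⟨-, η, hη, U, hU, -, -, -, -, hφ, hineq⟩ := hKL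
  obtain ⟨ε, hε, hεU⟩ := Metric.mem_nhds_iff.1 hU
  -- `η` may be infinite; a real threshold at most `1` also gives the bound `h ≤ 1` needed to
  -- compare powers.
  obtain ⟨e, he0, he1, he⟩ : ∃ e > (0 : ℝ), e ≤ 1 ∧ (e : EReal) ≤ η := by
    obtain ⟨t, ht0, htη⟩ := EReal.lt_iff_exists_real_btwn.1 hη
    exact ⟨min t 1, lt_min (by exact_mod_cast ht0) one_pos, min_le_right _ _,
      le_trans (by exact_mod_cast min_le_left t 1) htη.le⟩
  refine ⟨ε, hε, e, he0, he1, fun y v Hy hy hHy hv hpos hlt => ?_⟩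
  have hsub : H y - H xs = ((Hy - Hs : ℝ) : EReal) := by rw [hHy, hHs]; norm_cast
  have h1 := hineq y (hεU (mem_ball_iff_norm.2 hy)) (by
      rw [hHs, hHy]; exact_mod_cast sub_pos.1 hpos) (by
      rw [hHs, hHy]
      calc (Hy : EReal) < ((Hs + e : ℝ) : EReal) := by exact_mod_cast (by linarith)
        _ = Hs + e := by norm_cast
        _ ≤ _ := by gcongr)
  rw [hsub, EReal.toReal_coe] at h1
  have hd : deriv (fun s : ℝ => c * s ^ (1 - θ)) (Hy - Hs) = c * (1 - θ) * (Hy - Hs) ^ (-θ) := by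
    have := ((Real.hasDerivAt_rpow_const (x := Hy - Hs) (p := 1 - θ)
      (Or.inl hpos.ne')).const_mul c).deriv
    rw [this, show 1 - θ - 1 = -θ by ring]; ring
  have hdpos := (hφ (Hy - Hs) hpos (lt_of_lt_of_le (by exact_mod_cast hlt) he)).2
  have h2 : Metric.infEDist (0 : E) (limitingSubdiff H y) ≤ ENNReal.ofReal ‖v‖ := by
    refine (Metric.infEDist_le_edist_of_mem hv).trans ?_
    rw [edist_zero_left, ofReal_norm]
    exact le_rfl
  have h3 : (1 : ENNReal) ≤ ENNReal.ofReal (c * (1 - θ) * (Hy - Hs) ^ (-θ) * ‖v‖) := by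
    rw [hd] at h1 hdpos
    rw [ENNReal.ofReal_mul hdpos.le]
    exact h1.trans (by gcongr)
  rw [ENNReal.one_le_ofReal, Real.rpow_neg hpos.le] at h3
  have hq : 0 < (Hy - Hs) ^ θ := Real.rpow_pos_of_pos hpos θ
  calc (Hy - Hs) ^ θ = (Hy - Hs) ^ θ * 1 := (mul_one _).symm
    _ ≤ (Hy - Hs) ^ θ * (c * (1 - θ) * ((Hy - Hs) ^ θ)⁻¹ * ‖v‖) := by gcongr
    _ = _ := by field_simp

variable {F : E → ℝ} {R : E → EReal} {g : E → E} {α a M Lg : ℝ} {x : ℕ → E} {xs : E}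

/-- For a proximal gradient sequence with sufficient decrease and cluster point `xs`, the gaps
of the objective values to the value at `xs` are nonnegative and tend to zero, and so do the
steps. -/
theorem tendsto_gap_of_isProx (hα : 0 < α) (ha : 0 < a)
    (hFc : Continuous F) (hgc : Continuous g) (hbot : ∀ u, R u ≠ ⊥) (hxs : R xs ≠ ⊤)
    (hlsc : LowerSemicontinuousAt R xs)
    (hprox : ∀ k, IsProx α R (x k - α • g (x k)) (x (k + 1)))
    (hdesc : ∀ k, R (x k) ≠ ⊤ → F (x (k + 1)) + (R (x (k + 1))).toReal
      + a * ‖x (k + 1) - x k‖ ^ 2 ≤ F (x k) + (R (x k)).toReal)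
    (hclus : MapClusterPt xs atTop x) :
    (∀ k ≥ 1, F xs + (R xs).toReal ≤ F (x k) + (R (x k)).toReal) ∧
    Tendsto (fun k => F (x k) + (R (x k)).toReal - (F xs + (R xs).toReal)) atTop (𝓝 0) ∧
    Tendsto (fun k => ‖x (k + 1) - x k‖) atTop (𝓝 0) := by
  set h : ℕ → ℝ := fun k => F (x k) + (R (x k)).toReal - (F xs + (R xs).toReal) with hh
  have hfin : ∀ k, R (x (k + 1)) ≠ ⊤ := fun k => (hprox k).ne_top hα hbot ⟨xs, hxs⟩
  have hcoe : ∀ k, R (x (k + 1)) = ((R (x (k + 1))).toReal : EReal) := fun k =>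
    (EReal.coe_toReal (hfin k) (hbot _)).symm
  have hcoes : R xs = ((R xs).toReal : EReal) := (EReal.coe_toReal hxs (hbot _)).symm
  have hd : ∀ k, h (k + 1 + 1) + a * ‖x (k + 1 + 1) - x (k + 1)‖ ^ 2 ≤ h (k + 1) := fun k => by
    have := hdesc (k + 1) (hfin k)
    simp only [hh]; linarith
  have hanti : Antitone fun k => h (k + 1) := antitone_nat_of_succ_le fun k => by
    nlinarith [hd k, mul_nonneg ha.le (sq_nonneg ‖x (k + 1 + 1) - x (k + 1)‖)]
  -- A negative gap `-2δ` would persist by monotonicity, while near `xs` semicontinuity of `R` and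
  -- continuity of `F` each lose less than `δ`.
  have h0 : ∀ k, 0 ≤ h (k + 1) := by
    intro k
    by_contra! hneg
    set δ := -h (k + 1) / 2 with hδ
    have hδ0 : 0 < δ := by linarith
    have h1 : ∀ᶠ u in 𝓝 xs, (((R xs).toReal - δ : ℝ) : EReal) < R u :=
      hlsc _ ((EReal.coe_lt_coe_iff.2 (show (R xs).toReal - δ < (R xs).toReal by
        linarith)).trans_eq hcoes.symm)
    have h2 : ∀ᶠ u in 𝓝 xs, F xs - δ < F u :=
      hFc.continuousAt.eventually_const_lt (by linarith)
    obtain ⟨l, hl1, hl2⟩ := ((hclus.frequently (h1.and h2)).and_eventually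
      (eventually_ge_atTop (k + 1))).exists
    obtain ⟨j, rfl⟩ : ∃ j, l = j + 1 := ⟨l - 1, by omega⟩
    obtain ⟨h3, h4⟩ := hl1
    rw [hcoe j] at h3
    have h3' : (R xs).toReal - δ < (R (x (j + 1))).toReal := by exact_mod_cast h3
    have h5 : h (j + 1) ≤ h (k + 1) := hanti (show k ≤ j by omega)
    simp only [hh] at h5 hδ hneg
    linarith
  have hdist : Tendsto (fun k => ‖x (k + 1) - x k‖) atTop (𝓝 0) := by
    rw [← tendsto_add_atTop_iff_nat 1]
    have hlim := tendsto_atTop_ciInf hanti ⟨0, by rintro _ ⟨k, rfl⟩; exact h0 k⟩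
    have h1 : Tendsto (fun k => (h (k + 1) - h (k + 1 + 1)) / a) atTop (𝓝 0) := by
      have := (hlim.sub ((tendsto_add_atTop_iff_nat 1).2 hlim)).div_const a
      simpa using this
    have h2 : Tendsto (fun k => ‖x (k + 1 + 1) - x (k + 1)‖ ^ 2) atTop (𝓝 0) := by
      refine squeeze_zero (fun k => by positivity) (fun k => ?_) h1
      rw [le_div_iff₀ ha]
      linarith [hd k]
    have h3 := h2.sqrt
    simpa [Real.sqrt_sq (norm_nonneg _)] using h3
  refine ⟨fun k hk => ?_, ?_, hdist⟩
  · obtain ⟨j, rfl⟩ : ∃ j, k = j + 1 := ⟨k - 1, by omega⟩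
    exact sub_nonneg.1 (h0 j)
  · rw [← tendsto_add_atTop_iff_nat 1]
    obtain ⟨φ, hφ, hxφ⟩ := hclus.tendsto_subseq
    have hxφ' : Tendsto (fun j => x (φ j)) atTop (𝓝 xs) := hxφ
    have hx1 : Tendsto (fun j => x (φ j + 1)) atTop (𝓝 xs) := by
      have h1 : Tendsto (fun k => x (k + 1) - x k) atTop (𝓝 0) :=
        tendsto_zero_iff_norm_tendsto_zero.2 hdist
      simpa using hxφ'.add (h1.comp hφ.tendsto_atTop)
    have hz : Tendsto (fun j => x (φ j) - α • g (x (φ j))) atTop (𝓝 (xs - α • g xs)) :=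
      hxφ'.sub (((hgc.tendsto xs).comp hxφ').const_smul α)
    -- Semicontinuity only bounds the gap below. The upper bound comes from testing the proximal
    -- step against `xs`: along the subsequence both squared distances have the same limit.
    have hbd : ∀ j, h (φ j + 1) ≤ F (x (φ j + 1)) - F xs
        + (‖xs - (x (φ j) - α • g (x (φ j)))‖ ^ 2
          - ‖x (φ j + 1) - (x (φ j) - α • g (x (φ j)))‖ ^ 2) / (2 * α) := by
      intro j
      have h1 := (hprox (φ j)).real_le (hcoe _) hcoes
      have h2 : (R (x (φ j + 1))).toReal - (R xs).toReal ≤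
          (‖xs - (x (φ j) - α • g (x (φ j)))‖ ^ 2
          - ‖x (φ j + 1) - (x (φ j) - α • g (x (φ j)))‖ ^ 2) / (2 * α) := by
        rw [le_div_iff₀ (by positivity)]
        linarith
      simp only [hh]; linarith
    have hq : Tendsto (fun j => F (x (φ j + 1)) - F xs
        + (‖xs - (x (φ j) - α • g (x (φ j)))‖ ^ 2
          - ‖x (φ j + 1) - (x (φ j) - α • g (x (φ j)))‖ ^ 2) / (2 * α)) atTop (𝓝 0) := by
      have := (((hFc.tendsto xs).comp hx1).sub_const (F xs)).add
        ((((hz.const_sub xs).norm.pow 2).sub ((hx1.sub hz).norm.pow 2)).div_const (2 * α))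
      simpa using this
    rw [Metric.tendsto_atTop]
    intro δ hδ
    obtain ⟨j, hj⟩ := (hq.eventually_lt_const hδ).exists
    refine ⟨φ j, fun k hk => ?_⟩
    rw [Real.dist_0_eq_abs]
    have h3 : h (k + 1) ≤ h (φ j + 1) := hanti hk
    change |h (k + 1)| < δ
    rw [abs_of_nonneg (h0 k)]
    linarith [hbd j]

/-- Convergence rates of proximal gradient sequences under a Łojasiewicz exponent. -/
theorem proximalGradient_rates {c θ : ℝ} (hα : 0 < α) (ha : 0 < a) (hM : 0 ≤ M) (hLg : 0 ≤ Lg)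
    (hc : 0 < c) (hFc : Continuous F)
    (hF : ∀ y u, F y + inner ℝ (g y) (u - y) - M * ‖u - y‖ ^ 2 ≤ F u)
    (hg : ∀ y u, ‖g y - g u‖ ≤ Lg * ‖y - u‖) (hbot : ∀ u, R u ≠ ⊥)
    (hlsc : LowerSemicontinuousAt R xs)
    (hprox : ∀ k, IsProx α R (x k - α • g (x k)) (x (k + 1)))
    (hdesc : ∀ k, R (x k) ≠ ⊤ → F (x (k + 1)) + (R (x (k + 1))).toReal
      + a * ‖x (k + 1) - x k‖ ^ 2 ≤ F (x k) + (R (x k)).toReal)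
    (hclus : MapClusterPt xs atTop x)
    (hKL : HasKLPropertyWith (fun u => (F u : EReal) + R u) xs (fun s : ℝ => c * s ^ (1 - θ))) :
    (θ = 0 → ∃ K : ℕ, ∀ k ≥ K, x k = xs) ∧
    (0 < θ → θ ≤ 1 / 2 → ∃ (K : ℕ) (C₁ τ : ℝ), 0 < K ∧ 0 < C₁ ∧ 0 ≤ τ ∧ τ < 1 ∧
      ∀ k ≥ K, ‖x k - xs‖ ≤ C₁ * τ ^ k) ∧
    (1 / 2 < θ → θ < 1 → ∃ (K : ℕ) (C₁ : ℝ), 0 < K ∧ 0 < C₁ ∧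
      ∀ k ≥ K, ‖x k - xs‖ ≤ C₁ * (k : ℝ) ^ (-(1 - θ) / (2 * θ - 1))) := by
  have hxs : R xs ≠ ⊤ := by
    obtain ⟨v, hv, -⟩ := hKL.1
    rintro hc
    exact hv (by simp only [hc, EReal.coe_add_top])
  have hgc : Continuous g := by
    have : LipschitzWith ⟨Lg, hLg⟩ g := LipschitzWith.of_dist_le_mul fun y u => by
      rw [dist_eq_norm, dist_eq_norm]; exact hg y u
    exact this.continuous
  obtain ⟨hgap0, hgap, hdist⟩ :=
    tendsto_gap_of_isProx hα ha hFc hgc hbot hxs hlsc hprox hdesc hclus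
  set h : ℕ → ℝ := fun k => F (x k) + (R (x k)).toReal - (F xs + (R xs).toReal) with hh
  have hfin : ∀ k, R (x (k + 1)) ≠ ⊤ := fun k => (hprox k).ne_top hα hbot ⟨xs, hxs⟩
  have hval : ∀ u, R u ≠ ⊤ →
      (F u : EReal) + R u = ((F u + (R u).toReal : ℝ) : EReal) := fun u hu => by
    rw [EReal.coe_add, EReal.coe_toReal hu (hbot _)]
  have h0 : ∀ k ≥ 1, 0 ≤ h k := fun k hk => sub_nonneg.2 (hgap0 k hk)
  have hd : ∀ k ≥ 1, h (k + 1) + a * ‖x (k + 1) - x k‖ ^ 2 ≤ h k := fun k hk => by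
    obtain ⟨j, rfl⟩ : ∃ j, k = j + 1 := ⟨k - 1, by omega⟩
    have := hdesc (j + 1) (hfin j)
    simp only [hh]; linarith
  obtain ⟨ε, hε, e, he, he1, hineq⟩ := hKL.rpow_le (hval xs hxs)
  have hrates : ∀ (hθ0 : 0 ≤ θ) (hθ1 : θ < 1), ∃ κ > 0, ∃ B ≥ 0, ∃ N ≥ 1, ∀ k ≥ N,
      h (k + 1) ≤ 1 ∧ (0 < h (k + 1) → h (k + 1) ^ θ ≤ κ * ‖x (k + 1) - x k‖) ∧
      ‖x (k + 1) - xs‖ ≤ ‖x (k + 1) - x k‖ + B * h (k + 1) ^ (1 - θ) := by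
    intro hθ0 hθ1
    have hθ : 0 < 1 - θ := by linarith
    have hb : 0 < Lg + α⁻¹ := by positivity
    set κ := c * (1 - θ) * (Lg + α⁻¹) with hκ
    have hκ0 : 0 < κ := by positivity
    have hloj : ∀ k ≥ 1, ‖x (k + 1) - xs‖ < ε → 0 < h (k + 1) → h (k + 1) < e →
        h (k + 1) ^ θ ≤ κ * ‖x (k + 1) - x k‖ := by
      intro k _ hk1 hk2 hk3
      have hv := frechetSubdiff_subset_limitingSubdiff _ _
        (mem_frechetSubdiff_of_isProx hα hM (hF (x (k + 1))) hbot (hfin k) (hprox k))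
      have h1 := hineq _ _ _ hk1 (hval _ (hfin k)) hv hk2 hk3
      have h2 : ‖g (x (k + 1)) - g (x k) - α⁻¹ • (x (k + 1) - x k)‖
          ≤ (Lg + α⁻¹) * ‖x (k + 1) - x k‖ := by
        refine (norm_sub_le _ _).trans ?_
        rw [norm_smul, Real.norm_of_nonneg (by positivity), add_mul]
        gcongr
        exact hg _ _
      calc h (k + 1) ^ θ ≤ _ := h1
        _ ≤ c * (1 - θ) * ((Lg + α⁻¹) * ‖x (k + 1) - x k‖) := by gcongr
        _ = _ := by rw [hκ]; ring
    obtain ⟨N, hN, hconv⟩ := norm_sub_le_of_lojasiewicz ha hκ0 hθ1 hθ0 hε he h0 hd hgap hdist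
      hclus hloj
    exact ⟨κ, hκ0, _, by positivity, N, hN, fun k hk => ⟨(hconv k hk).2.1.le.trans he1,
      fun hp => hloj k (hN.trans hk) (hconv k hk).1 hp (hconv k hk).2.1, (hconv k hk).2.2⟩⟩
  have hle1 : ∀ {N : ℕ}, (∀ k ≥ N, h (k + 1) ≤ 1) → ∀ k ≥ N + 1, h k ≤ 1 := fun hN k hk => by
    obtain ⟨j, rfl⟩ : ∃ j, k = j + 1 := ⟨k - 1, by omega⟩
    exact hN j (by omega)
  -- For `θ > 0` the bound extends to zero gaps because `0 ^ θ = 0`; at `θ = 0` it does not, so that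
  -- case keeps the positivity condition.
  have hloj0 : ∀ {N : ℕ} {κ : ℝ}, 0 < κ → 0 < θ → (∀ k ≥ N, 0 < h (k + 1) →
      h (k + 1) ^ θ ≤ κ * ‖x (k + 1) - x k‖) → ∀ k ≥ N + 1,
      h (k + 1) ^ θ ≤ κ * ‖x (k + 1) - x k‖ := fun hκ hθ hN k hk => by
    rcases (h0 (k + 1) (by omega)).eq_or_lt with hz | hp
    · rw [← hz, Real.zero_rpow hθ.ne']; positivity
    · exact hN k (by omega) hp
  refine ⟨fun hθ => ?_, fun hθ0 hθ1 => ?_, fun hθ0 hθ1 => ?_⟩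
  · obtain ⟨κ, hκ, B, hB, N, hN, hr⟩ := hrates hθ.ge (by linarith)
    subst hθ
    simp only [sub_zero, Real.rpow_one, Real.rpow_zero] at hr
    exact eventually_eq_of_lojasiewicz_zero ha (fun k hk => h0 k (hN.trans hk))
      (fun k hk => hd k (hN.trans hk)) hdist (fun k hk => (hr k hk).2.1)
      (fun k hk => (hr k hk).2.2)
  · obtain ⟨κ, hκ, B, hB, N, hN, hr⟩ := hrates hθ0.le (by linarith)
    exact linear_rate_of_lojasiewicz (N := N + 1) ha hκ hB hθ1 (fun k hk => h0 k (by omega))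
      (hle1 fun k hk => (hr k hk).1) (fun k hk => hd k (by omega))
      (hloj0 hκ hθ0 fun k hk => (hr k hk).2.1) (fun k hk => (hr k (by omega)).2.2)
  · obtain ⟨κ, hκ, B, hB, N, hN, hr⟩ := hrates (by linarith) hθ1
    exact sublinear_rate_of_lojasiewicz (N := N + 1) ha hκ hB hθ0 hθ1 (by omega)
      (fun k hk => h0 k (by omega))
      (hle1 fun k hk => (hr k hk).1) (fun k hk => hd k (by omega))
      (hloj0 hκ (by linarith) fun k hk => (hr k hk).2.1) (fun k hk => (hr k (by omega)).2.2)

end ProximalGradient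

/-! ### Mixing matrices and Taylor estimates for the smooth part -/

section SmoothPart

/-- First-order Taylor estimate for a function with Lipschitz gradient. -/
theorem abs_sub_sub_inner_gradient_le {E : Type*} [NormedAddCommGroup E] [InnerProductSpace ℝ E]
    [CompleteSpace E] {f : E → ℝ} {L : ℝ} (hf : Differentiable ℝ f)
    (hL : ∀ u v, ‖gradient f u - gradient f v‖ ≤ L * ‖u - v‖) (u v : E) :
    |f v - f u - inner ℝ (gradient f u) (v - u)| ≤ L / 2 * ‖v - u‖ ^ 2 := by
  set d := v - u with hd
  have hder : ∀ t : ℝ, HasDerivAt (fun t : ℝ => f (u + t • d) - f u - t * inner ℝ (gradient f u) d)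
      (inner ℝ (gradient f (u + t • d) - gradient f u) d) t := by
    intro t
    have h1 : HasDerivAt (fun t : ℝ => u + t • d) d t := by
      simpa using ((hasDerivAt_id t).smul_const d).const_add u
    have h2 := (hf (u + t • d)).hasGradientAt.hasFDerivAt.comp_hasDerivAt t h1
    have h3 := (h2.sub_const (f u)).sub
      ((hasDerivAt_id t).mul_const (inner ℝ (gradient f u) d))
    refine HasDerivAt.congr_deriv h3 ?_
    rw [inner_sub_left, one_mul, InnerProductSpace.toDual_apply_apply]
  have hB : ∀ t : ℝ, HasDerivAt (fun t : ℝ => L * ‖d‖ ^ 2 / 2 * t ^ 2) (L * ‖d‖ ^ 2 * t) t := by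
    intro t
    refine ((hasDerivAt_pow 2 t).const_mul (L * ‖d‖ ^ 2 / 2)).congr_deriv ?_
    simp only [Nat.cast_ofNat, Nat.add_one_sub_one, pow_one]
    ring
  -- The remainder along the segment has derivative at most `L‖d‖² t`; a comparison theorem replaces
  -- integration.
  have key := image_norm_le_of_norm_deriv_right_le_deriv_boundary (a := (0 : ℝ)) (b := 1)
    (f := fun t : ℝ => f (u + t • d) - f u - t * inner ℝ (gradient f u) d)
    (fun t _ => (hder t).continuousAt.continuousWithinAt)
    (fun t _ => (hder t).hasDerivWithinAt) (B := fun t : ℝ => L * ‖d‖ ^ 2 / 2 * t ^ 2)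
    (by simp) hB (fun t ht => by
      refine (norm_inner_le_norm _ _).trans ?_
      have := hL (u + t • d) u
      rw [add_sub_cancel_left, norm_smul, Real.norm_of_nonneg ht.1] at this
      nlinarith [norm_nonneg d]) (Set.right_mem_Icc.2 zero_le_one)
  simp only [one_smul, one_mul, one_pow, mul_one, Real.norm_eq_abs] at key
  rw [hd, add_sub_cancel] at key
  convert key using 1
  rw [hd]; ring

variable {n p : ℕ}

theorem mix_apply (A : Matrix (Fin n) (Fin n) ℝ) (x : Stacked n p) (i : Fin n) :
    mix A x i = ∑ j, A i j • x j := rfl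

theorem mix_add (A : Matrix (Fin n) (Fin n) ℝ) (x y : Stacked n p) :
    mix A (x + y) = mix A x + mix A y := by
  ext1 i
  simp [mix_apply, Finset.sum_add_distrib]

theorem mix_smul (A : Matrix (Fin n) (Fin n) ℝ) (c : ℝ) (x : Stacked n p) :
    mix A (c • x) = c • mix A x := by
  ext1 i
  simp [mix_apply, Finset.smul_sum, smul_comm c]

/-- `mix A` as a linear map. -/
def mixLinear (A : Matrix (Fin n) (Fin n) ℝ) : Stacked n p →ₗ[ℝ] Stacked n p where
  toFun := mix A
  map_add' := mix_add A
  map_smul' := mix_smul A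

theorem exists_bound_of_linearMap {V : Type*} [NormedAddCommGroup V] [NormedSpace ℝ V]
    [FiniteDimensional ℝ V] (T : V →ₗ[ℝ] V) : ∃ K : ℝ, 0 ≤ K ∧ ∀ v, ‖T v‖ ≤ K * ‖v‖ :=
  ⟨‖T.toContinuousLinearMap‖, norm_nonneg _, T.toContinuousLinearMap.le_opNorm⟩

theorem exists_norm_mix_le (A : Matrix (Fin n) (Fin n) ℝ) :
    ∃ K : ℝ, 0 ≤ K ∧ ∀ x : Stacked n p, ‖mix A x‖ ≤ K * ‖x‖ :=
  exists_bound_of_linearMap (mixLinear A)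

theorem mix_sub (A : Matrix (Fin n) (Fin n) ℝ) (x y : Stacked n p) :
    mix A (x - y) = mix A x - mix A y := (mixLinear A).map_sub x y

theorem continuous_mix (A : Matrix (Fin n) (Fin n) ℝ) :
    Continuous (mix A : Stacked n p → Stacked n p) := by
  obtain ⟨K, hK, h⟩ := exists_norm_mix_le (p := p) A
  have : LipschitzWith ⟨K, hK⟩ (mix A : Stacked n p → Stacked n p) :=
    LipschitzWith.of_dist_le_mul fun x y => by
      rw [dist_eq_norm, dist_eq_norm, ← mix_sub]; exact h _
  exact this.continuous

theorem mix_sub_left (A B : Matrix (Fin n) (Fin n) ℝ) (x : Stacked n p) :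
    mix (A - B) x = mix A x - mix B x := by
  ext1 i
  simp [mix_apply, sub_smul]

theorem mix_smul_one (c : ℝ) (x : Stacked n p) :
    mix (c • (1 : Matrix (Fin n) (Fin n) ℝ)) x = c • x := by
  ext1 i
  simp [mix_apply, Matrix.one_apply]

theorem mix_one (x : Stacked n p) : mix (1 : Matrix (Fin n) (Fin n) ℝ) x = x := by
  simpa using mix_smul_one (n := n) 1 x

theorem inner_mix (A : Matrix (Fin n) (Fin n) ℝ) (x y : Stacked n p) :
    inner ℝ x (mix A y) = ∑ i, ∑ j, A i j * inner ℝ (x i) (y j) := by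
  simp [PiLp.inner_apply (𝕜 := ℝ) (f := fun _ : Fin n => Loc p), mix_apply, inner_sum,
    inner_smul_right]

theorem inner_mix_comm {A : Matrix (Fin n) (Fin n) ℝ} (hA : A.transpose = A)
    (x y : Stacked n p) : inner ℝ x (mix A y) = inner ℝ y (mix A x) := by
  rw [inner_mix, inner_mix, Finset.sum_comm]
  refine Finset.sum_congr rfl fun i _ => Finset.sum_congr rfl fun j _ => ?_
  rw [real_inner_comm, ← congrFun (congrFun hA i) j, Matrix.transpose_apply]

/-- The Frobenius form splits over columns into the quadratic forms of `A` on `ℝ^n`. -/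
theorem inner_mix_nonneg {A : Matrix (Fin n) (Fin n) ℝ} (hA : A.PosSemidef) (x : Stacked n p) :
    0 ≤ inner ℝ x (mix A x) := by
  have h1 : inner ℝ x (mix A x)
      = ∑ c, (fun i => x i c) ⬝ᵥ A.mulVec (fun i => x i c) := by
    rw [inner_mix]
    simp only [dotProduct, Matrix.mulVec, PiLp.inner_apply, Finset.mul_sum]
    rw [Finset.sum_comm' (t' := Finset.univ) (s' := fun _ => Finset.univ) (by simp)]
    rw [Finset.sum_comm]
    conv_rhs => rw [Finset.sum_comm]
    refine Finset.sum_congr rfl fun i _ => ?_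
    rw [Finset.sum_comm]
    refine Finset.sum_congr rfl fun c _ => Finset.sum_congr rfl fun j _ => ?_
    simp
    ring
  rw [h1]
  exact Finset.sum_nonneg fun c _ => by simpa using hA.dotProduct_mulVec_nonneg (fun i => x i c)

/-- Subtracting a scalar matrix translates the spectrum, whose finiteness makes `sInf` a genuine
lower bound. -/
theorem posSemidef_sub_lambdaMin_smul_one {W : Matrix (Fin n) (Fin n) ℝ} (hW : W.IsHermitian) :
    (W - lambdaMin W • (1 : Matrix (Fin n) (Fin n) ℝ)).PosSemidef := by
  rw [Matrix.posSemidef_iff_isHermitian_and_spectrum_nonneg]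
  refine ⟨hW.sub (by simp [Matrix.IsHermitian]), ?_⟩
  rw [← Algebra.algebraMap_eq_smul_one, ← spectrum.sub_singleton_eq]
  rintro _ ⟨μ, hμ, c, rfl, rfl⟩
  have hfin : (spectrum ℝ W).Finite := by
    rw [hW.spectrum_real_eq_range_eigenvalues]; exact Set.finite_range _
  exact sub_nonneg.2 (csInf_le hfin.bddBelow hμ)

theorem lambdaMin_mul_norm_sq_le {W : Matrix (Fin n) (Fin n) ℝ} (hW : W.transpose = W)
    (x : Stacked n p) : lambdaMin W * ‖x‖ ^ 2 ≤ inner ℝ x (mix W x) := by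
  have h := inner_mix_nonneg (posSemidef_sub_lambdaMin_smul_one (W := W)
    (by rw [Matrix.IsHermitian, Matrix.conjTranspose_eq_transpose_of_trivial, hW])) x
  rw [mix_sub_left, mix_smul_one, inner_sub_right, inner_smul_right,
    real_inner_self_eq_norm_sq] at h
  linarith

theorem le_maxLip (L : Fin n → ℝ) (i : Fin n) : L i ≤ maxLip L :=
  le_ciSup (Set.finite_range L).bddAbove i

variable {f : Fin n → Loc p → ℝ} {L : Fin n → ℝ}

/-- The gradient of `lyapunov f W α` for symmetric `W`. -/
def lyapunovGrad (f : Fin n → Loc p → ℝ) (W : Matrix (Fin n) (Fin n) ℝ) (α : ℝ)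
    (x : Stacked n p) : Stacked n p :=
  stackedGrad f x + α⁻¹ • mix (1 - W) x

theorem sub_smul_lyapunovGrad {W : Matrix (Fin n) (Fin n) ℝ} {α : ℝ} (hα : α ≠ 0)
    (x : Stacked n p) :
    x - α • lyapunovGrad f W α x = mix W x - α • stackedGrad f x := by
  rw [lyapunovGrad, smul_add, smul_smul, mul_inv_cancel₀ hα, one_smul, mix_sub_left, mix_one]
  abel

/-- The quadratic term is expanded exactly, so only the `f i` leave a remainder. This lets the upper
estimate use `lambdaMin W` and the lower one use `I - W ⪰ 0`. -/
theorem lyapunov_taylor {W : Matrix (Fin n) (Fin n) ℝ} {α : ℝ} (hW : W.transpose = W)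
    (hf : ∀ i, Differentiable ℝ (f i))
    (hL : ∀ i u v, ‖gradient (f i) u - gradient (f i) v‖ ≤ L i * ‖u - v‖) (x y : Stacked n p) :
    |lyapunov f W α y - lyapunov f W α x - inner ℝ (lyapunovGrad f W α x) (y - x)
      - 1 / (2 * α) * inner ℝ (y - x) (mix (1 - W) (y - x))| ≤ maxLip L / 2 * ‖y - x‖ ^ 2 := by
  have hA : (1 - W).transpose = 1 - W := by rw [Matrix.transpose_sub, hW, Matrix.transpose_one]
  have hquad : inner ℝ y (mix (1 - W) y) = inner ℝ x (mix (1 - W) x)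
      + 2 * inner ℝ (mix (1 - W) x) (y - x) + inner ℝ (y - x) (mix (1 - W) (y - x)) := by
    have h1 := inner_mix_comm hA x y
    rw [mix_sub]
    simp only [inner_sub_left, inner_sub_right]
    rw [real_inner_comm y (mix (1 - W) x), real_inner_comm x (mix (1 - W) x)]
    linarith
  have hsum : lyapunov f W α y - lyapunov f W α x - inner ℝ (lyapunovGrad f W α x) (y - x)
      - 1 / (2 * α) * inner ℝ (y - x) (mix (1 - W) (y - x))
      = ∑ i, (f i (y i) - f i (x i) - inner ℝ (gradient (f i) (x i)) (y i - x i)) := by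
    have h2 : inner ℝ (stackedGrad f x) (y - x)
        = ∑ i, inner ℝ (gradient (f i) (x i)) (y i - x i) := by
      rw [PiLp.inner_apply (𝕜 := ℝ) (f := fun _ : Fin n => Loc p)]; rfl
    rw [lyapunov, lyapunov, lyapunovGrad, hquad, inner_add_left, inner_smul_left, h2,
      Finset.sum_sub_distrib, Finset.sum_sub_distrib]
    simp only [conj_trivial]
    rw [one_div, mul_inv]
    ring
  rw [hsum, PiLp.norm_sq_eq_of_L2, Finset.mul_sum]
  refine (Finset.abs_sum_le_sum_abs _ _).trans (Finset.sum_le_sum fun i _ => ?_)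
  refine (abs_sub_sub_inner_gradient_le (hf i) (hL i) (x i) (y i)).trans ?_
  rw [PiLp.sub_apply]
  gcongr
  exact le_maxLip L i

theorem continuous_lyapunov {W : Matrix (Fin n) (Fin n) ℝ} {α : ℝ}
    (hf : ∀ i, Differentiable ℝ (f i)) : Continuous (lyapunov f W α) := by
  have h1 : Continuous (mix (1 - W) : Stacked n p → Stacked n p) :=
    continuous_mix (1 - W)
  unfold lyapunov
  refine Continuous.add (continuous_finsetSum _ fun i _ => (hf i).continuous.comp ?_)
    (continuous_const.mul (continuous_id.inner h1))
  fun_prop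

theorem norm_stackedGrad_sub_le (hLf : 0 ≤ maxLip L)
    (hL : ∀ i u v, ‖gradient (f i) u - gradient (f i) v‖ ≤ L i * ‖u - v‖) (x y : Stacked n p) :
    ‖stackedGrad f x - stackedGrad f y‖ ≤ maxLip L * ‖x - y‖ := by
  refine abs_le_of_sq_le_sq' ?_ (by positivity) |>.2
  rw [mul_pow, PiLp.norm_sq_eq_of_L2, PiLp.norm_sq_eq_of_L2, Finset.mul_sum]
  refine Finset.sum_le_sum fun i _ => ?_
  rw [← mul_pow]
  refine pow_le_pow_left₀ (norm_nonneg _) ?_ 2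
  refine (hL i (x i) (y i)).trans ?_
  rw [PiLp.sub_apply]
  gcongr
  exact le_maxLip L i

theorem exists_lipschitz_lyapunovGrad {W : Matrix (Fin n) (Fin n) ℝ} {α : ℝ} (hα : 0 < α)
    (hLf : 0 ≤ maxLip L)
    (hL : ∀ i u v, ‖gradient (f i) u - gradient (f i) v‖ ≤ L i * ‖u - v‖) :
    ∃ K : ℝ, 0 ≤ K ∧ ∀ x y : Stacked n p,
      ‖lyapunovGrad f W α x - lyapunovGrad f W α y‖ ≤ K * ‖x - y‖ := by
  obtain ⟨K, hK, hT⟩ := exists_norm_mix_le (p := p) (1 - W)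
  refine ⟨maxLip L + α⁻¹ * K, by positivity, fun x y => ?_⟩
  have h1 : lyapunovGrad f W α x - lyapunovGrad f W α y
      = (stackedGrad f x - stackedGrad f y) + α⁻¹ • mix (1 - W) (x - y) := by
    rw [mix_sub, lyapunovGrad, lyapunovGrad, smul_sub]
    abel
  rw [h1, add_mul, mul_assoc]
  refine (norm_add_le _ _).trans (add_le_add (norm_stackedGrad_sub_le hLf hL x y) ?_)
  rw [norm_smul, Real.norm_of_nonneg (by positivity)]
  gcongr
  exact hT _

end SmoothPart

/-! ### The regularizer and sufficient decrease -/

section Regularizer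

theorem EReal_sum_ne_bot {ι : Type*} (s : Finset ι) {φ : ι → EReal} (h : ∀ i, φ i ≠ ⊥) :
    ∑ i ∈ s, φ i ≠ ⊥ := by
  classical
  induction s using Finset.induction_on with
  | empty => simp
  | insert i s hi ih => rw [Finset.sum_insert hi]; exact EReal.add_ne_bot_iff.2 ⟨h i, ih⟩

theorem EReal_coe_sum {ι : Type*} (s : Finset ι) (φ : ι → ℝ) :
    ((∑ i ∈ s, φ i : ℝ) : EReal) = ∑ i ∈ s, (φ i : EReal) := by
  classical
  induction s using Finset.induction_on with
  | empty => simp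
  | insert i s hi ih => rw [Finset.sum_insert hi, Finset.sum_insert hi, EReal.coe_add, ih]

theorem lowerSemicontinuousAt_sum_EReal {X ι : Type*} [TopologicalSpace X] (s : Finset ι)
    {φ : ι → X → EReal} {x : X} (hbot : ∀ i u, φ i u ≠ ⊥)
    (h : ∀ i, LowerSemicontinuousAt (φ i) x) :
    LowerSemicontinuousAt (fun u => ∑ i ∈ s, φ i u) x := by
  classical
  induction s using Finset.induction_on with
  | empty => simpa using lowerSemicontinuousAt_const
  | insert i s hi ih =>
    simp only [Finset.sum_insert hi]
    exact (h i).add' ih (EReal.continuousAt_add (Or.inr (EReal_sum_ne_bot s fun j => hbot j x))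
      (Or.inl (hbot i x)))

variable {n p : ℕ} {f : Fin n → Loc p → ℝ} {r : Fin n → Loc p → EReal} {L : Fin n → ℝ}

theorem sumReg_ne_bot (hbot : ∀ i u, r i u ≠ ⊥) (x : Stacked n p) : sumReg r x ≠ ⊥ :=
  EReal_sum_ne_bot _ fun i => hbot i (x i)

theorem apply_ne_top_of_sumReg_ne_top (hbot : ∀ i u, r i u ≠ ⊥) {x : Stacked n p}
    (hx : sumReg r x ≠ ⊤) (i : Fin n) : r i (x i) ≠ ⊤ := by
  intro hi
  apply hx
  rw [sumReg, ← Finset.add_sum_erase _ _ (Finset.mem_univ i), hi]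
  exact EReal.top_add_of_ne_bot (EReal_sum_ne_bot _ fun j => hbot j (x j))

theorem sumReg_eq_coe (hbot : ∀ i u, r i u ≠ ⊥) {x : Stacked n p} (hx : sumReg r x ≠ ⊤) :
    sumReg r x = ((∑ i, (r i (x i)).toReal : ℝ) : EReal) := by
  rw [EReal_coe_sum]
  exact Finset.sum_congr rfl fun i _ =>
    (EReal.coe_toReal (apply_ne_top_of_sumReg_ne_top hbot hx i) (hbot i _)).symm

/-- Adding the finite continuous function `-f i` to `f i + r i` recovers `r i` and preserves
semicontinuity. -/
theorem CompositeObjective.lowerSemicontinuous_reg (h : CompositeObjective f r L) (i : Fin n) :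
    LowerSemicontinuous (r i) := by
  have heq : r i = fun u => ((-f i u : ℝ) : EReal) + ((f i u : EReal) + r i u) := by
    funext u
    rw [← add_assoc, ← EReal.coe_add, neg_add_cancel, EReal.coe_zero, zero_add]
  intro u
  rw [heq]
  refine LowerSemicontinuousAt.add' ?_ (h.lsc i u)
    (EReal.continuousAt_add (Or.inl (EReal.coe_ne_top _)) (Or.inl (EReal.coe_ne_bot _)))
  exact (continuous_coe_real_ereal.comp
    (h.differentiable i).continuous.neg).lowerSemicontinuous u

theorem CompositeObjective.lowerSemicontinuousAt_sumReg (h : CompositeObjective f r L)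
    (x : Stacked n p) : LowerSemicontinuousAt (sumReg r) x := by
  refine lowerSemicontinuousAt_sum_EReal Finset.univ (φ := fun i (u : Stacked n p) => r i (u i))
    (fun i u => h.ne_bot i _) fun i => ?_
  have hc : ContinuousAt (fun u : Stacked n p => u i) x := by fun_prop
  exact fun y hy => hc.eventually (h.lowerSemicontinuous_reg i (x i) y hy)

theorem sumReg_convex_comb_le (hbot : ∀ i u, r i u ≠ ⊥) (hconv : ∀ i, IsConvexFun (r i))
    {x y : Stacked n p} (hx : sumReg r x ≠ ⊤) (hy : sumReg r y ≠ ⊤) {t : ℝ} (ht0 : 0 < t)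
    (ht1 : t < 1) : sumReg r ((1 - t) • x + t • y) ≤
      (((1 - t) * (sumReg r x).toReal + t * (sumReg r y).toReal : ℝ) : EReal) := by
  rw [sumReg_eq_coe hbot hx, sumReg_eq_coe hbot hy, EReal.toReal_coe, EReal.toReal_coe,
    Finset.mul_sum, Finset.mul_sum, ← Finset.sum_add_distrib, EReal_coe_sum]
  refine Finset.sum_le_sum fun i _ => ?_
  have := hconv i (x i) (y i) (1 - t) t (by linarith) ht0 (by ring)
  rw [EReal.coe_add, EReal.coe_mul, EReal.coe_mul,
    EReal.coe_toReal (apply_ne_top_of_sumReg_ne_top hbot hx i) (hbot i _),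
    EReal.coe_toReal (apply_ne_top_of_sumReg_ne_top hbot hy i) (hbot i _)]
  exact this

/-- The three-point inequality of the proximal map of a convex function. -/
theorem IsProx.add_norm_sq_le {E : Type*} [NormedAddCommGroup E] [InnerProductSpace ℝ E]
    {α : ℝ} {R : E → EReal} {z y u : E} {ρ σ : ℝ} (hα : 0 < α) (h : IsProx α R z y)
    (hy : R y = ρ) (hconv : ∀ t : ℝ, 0 < t → t < 1 →
      R ((1 - t) • y + t • u) ≤ (((1 - t) * ρ + t * σ : ℝ) : EReal)) :
    α * ρ + ‖y - z‖ ^ 2 / 2 + ‖u - y‖ ^ 2 / 2 ≤ α * σ + ‖u - z‖ ^ 2 / 2 := by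
  have hineq : ∀ t : ℝ, 0 < t → t < 1 →
      α * ρ ≤ α * σ + inner ℝ (y - z) (u - y) + t * (‖u - y‖ ^ 2 / 2) := by
    intro t ht0 ht1
    have h1 := h ((1 - t) • y + t • u)
    have h2 : ((α * ρ + ‖y - z‖ ^ 2 / 2 : ℝ) : EReal) ≤
        ((α * ((1 - t) * ρ + t * σ) + ‖(1 - t) • y + t • u - z‖ ^ 2 / 2 : ℝ) : EReal) := by
      rw [hy] at h1
      rw [EReal.coe_add, EReal.coe_mul, EReal.coe_add (α * _), EReal.coe_mul α ((1 - t) * ρ + t * σ)]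
      refine h1.trans (add_le_add (mul_le_mul_of_nonneg_left (hconv t ht0 ht1) ?_) le_rfl)
      exact_mod_cast hα.le
    rw [EReal.coe_le_coe_iff, norm_sub_sq_sub_norm_sub_sq y ((1 - t) • y + t • u),
      show (1 - t) • y + t • u - y = t • (u - y) by module, inner_smul_right, norm_smul,
      Real.norm_of_nonneg ht0.le, mul_pow] at h2
    have h3 : t * (α * ρ) ≤ t * (α * σ + inner ℝ (y - z) (u - y) + t * (‖u - y‖ ^ 2 / 2)) := by
      linarith
    exact le_of_mul_le_mul_left h3 ht0
  -- Letting `t → 0` removes the quadratic term from the comparison, which leaves the extra `‖u -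
  -- y‖² / 2` in the conclusion.
  have hlim : α * ρ ≤ α * σ + inner ℝ (y - z) (u - y) := by
    have ht : Tendsto (fun t : ℝ => α * σ + inner ℝ (y - z) (u - y) + t * (‖u - y‖ ^ 2 / 2))
        (𝓝[>] 0) (𝓝 (α * σ + inner ℝ (y - z) (u - y) + 0 * (‖u - y‖ ^ 2 / 2))) :=
      (Continuous.tendsto (by fun_prop) 0).mono_left nhdsWithin_le_nhds
    rw [zero_mul, add_zero] at ht
    refine ge_of_tendsto ht ?_
    filter_upwards [Ioo_mem_nhdsGT one_pos] with t ht
    exact hineq t ht.1 ht.2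
  rw [norm_sub_sq_sub_norm_sub_sq y u z]
  linarith

/-- Sufficient decrease of the Lyapunov function along a proximal step whose proximal inequality
has modulus `s`: `s = 1` in general and `s = 2` for convex regularizers. -/
theorem lyapunov_sufficient_decrease {W : Matrix (Fin n) (Fin n) ℝ} {α s ρx ρy : ℝ} (hα : 0 < α)
    (hW : W.transpose = W) (hf : ∀ i, Differentiable ℝ (f i))
    (hL : ∀ i u v, ‖gradient (f i) u - gradient (f i) v‖ ≤ L i * ‖u - v‖) {x y z : Stacked n p}
    (hz : z = x - α • lyapunovGrad f W α x)
    (hprox : α * ρy + ‖y - z‖ ^ 2 / 2 + (s - 1) * (‖y - x‖ ^ 2 / 2) ≤ α * ρx + ‖x - z‖ ^ 2 / 2) :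
    lyapunov f W α y + ρy + (s - 1 + lambdaMin W - α * maxLip L) / (2 * α) * ‖y - x‖ ^ 2
      ≤ lyapunov f W α x + ρx := by
  have h1 := (abs_le.1 (lyapunov_taylor (α := α) hW hf hL x y)).2
  have h2 := lambdaMin_mul_norm_sq_le hW (y - x)
  rw [mix_sub_left, mix_one, inner_sub_right (y - x) (y - x),
    real_inner_self_eq_norm_sq] at h1
  rw [norm_sub_sq_sub_norm_sub_sq x y z,
    show x - z = α • lyapunovGrad f W α x by rw [hz]; abel, inner_smul_left, conj_trivial] at hprox
  set D := ‖y - x‖ ^ 2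
  set I := inner ℝ (lyapunovGrad f W α x) (y - x)
  set Q := inner ℝ (y - x) (mix W (y - x))
  have h3 : ρy + I + s / (2 * α) * D ≤ ρx := by
    have : α * (ρy + I + s / (2 * α) * D) ≤ α * ρx := by
      have : α * (ρy + I + s / (2 * α) * D) = α * ρy + α * I + s * D / 2 := by field_simp
      rw [this]; linarith
    exact le_of_mul_le_mul_left this hα
  have h4 : (s - 1 + lambdaMin W - α * maxLip L) / (2 * α) * D
      = s / (2 * α) * D - 1 / (2 * α) * (D - lambdaMin W * D) - maxLip L / 2 * D := by
    field_simp; ring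
  have h5 : 1 / (2 * α) * (D - Q) ≤ 1 / (2 * α) * (D - lambdaMin W * D) := by gcongr
  rw [h4]
  linarith

end Regularizer

end ProxDGD

end

/-! ### Prox-DGD as a proximal gradient method -/

theorem proposition5 {n p : ℕ} (G : SimpleGraph (Fin n)) (hG : G.Connected)
    (W : Matrix (Fin n) (Fin n) ℝ) (hW : ProxDGD.IsMixingMatrix G W)
    (f : Fin n → ProxDGD.Loc p → ℝ) (r : Fin n → ProxDGD.Loc p → EReal) (L : Fin n → ℝ)
    (hfr : ProxDGD.CompositeObjective f r L)
    (α : ℝ) (hα : ProxDGD.StepSizeCondition r W L α)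
    (x : ℕ → ProxDGD.Stacked n p) (hx : ProxDGD.IsProxDGD f r W α x)
    (xs : ProxDGD.Stacked n p) (hxs : MapClusterPt xs Filter.atTop x)
    (c₁ θ : ℝ) (hc₁ : 0 < c₁)
    (hKL : ProxDGD.HasKLPropertyWith (ProxDGD.compositeLyapunov f r W α) xs
      (fun s : ℝ => c₁ * s ^ (1 - θ))) :
    (θ = 0 → ∃ K : ℕ, ∀ k ≥ K, x k = xs) ∧
    (0 < θ → θ ≤ 1 / 2 → ∃ (K : ℕ) (C₁ τ : ℝ), 0 < K ∧ 0 < C₁ ∧ 0 ≤ τ ∧ τ < 1 ∧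
      ∀ k ≥ K, ‖x k - xs‖ ≤ C₁ * τ ^ k) ∧
    (1 / 2 < θ → θ < 1 → ∃ (K : ℕ) (C₁ : ℝ), 0 < K ∧ 0 < C₁ ∧
      ∀ k ≥ K, ‖x k - xs‖ ≤ C₁ * (k : ℝ) ^ (-(1 - θ) / (2 * θ - 1))) := by
  obtain ⟨i₀⟩ := hG.nonempty
  have hLf : 0 < ProxDGD.maxLip L := (hfr.lip_pos i₀).trans_le (ProxDGD.le_maxLip L i₀)
  obtain ⟨hα0, hcases⟩ := hα
  have hbot := ProxDGD.sumReg_ne_bot hfr.ne_bot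
  have hprox : ∀ k, ProxDGD.IsProx α (ProxDGD.sumReg r)
      (x k - α • ProxDGD.lyapunovGrad f W α (x k)) (x (k + 1)) := fun k => by
    rw [ProxDGD.sub_smul_lyapunovGrad hα0.ne']; exact hx k
  have hxsfin : ProxDGD.sumReg r xs ≠ ⊤ := by
    obtain ⟨v, hv, -⟩ := hKL.1
    intro h
    exact hv (by rw [ProxDGD.compositeLyapunov, h, EReal.coe_add_top])
  have hfin : ∀ k, ProxDGD.sumReg r (x (k + 1)) ≠ ⊤ := fun k =>
    (hprox k).ne_top hα0 hbot ⟨xs, hxsfin⟩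
  have hcoe : ∀ {u}, ProxDGD.sumReg r u ≠ ⊤ →
      ProxDGD.sumReg r u = ((ProxDGD.sumReg r u).toReal : EReal) := fun {u} hu =>
    (EReal.coe_toReal hu (hbot u)).symm
  obtain ⟨a, ha, hdesc⟩ : ∃ a : ℝ, 0 < a ∧ ∀ k, ProxDGD.sumReg r (x k) ≠ ⊤ →
      ProxDGD.lyapunov f W α (x (k + 1)) + (ProxDGD.sumReg r (x (k + 1))).toReal
        + a * ‖x (k + 1) - x k‖ ^ 2
      ≤ ProxDGD.lyapunov f W α (x k) + (ProxDGD.sumReg r (x k)).toReal := by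
    rcases hcases with ⟨hconv, hstep⟩ | ⟨-, hstep⟩
    · rw [lt_div_iff₀ hLf] at hstep
      -- Modulus `s = 2`: positivity is exactly `α L_f < 1 + λ_n`. The nonconvex case below has `s =
      -- 1` and needs `α L_f < λ_n`.
      refine ⟨(2 - 1 + ProxDGD.lambdaMin W - α * ProxDGD.maxLip L) / (2 * α),
        div_pos (by linarith) (by positivity), fun k hk => ?_⟩
      refine ProxDGD.lyapunov_sufficient_decrease hα0 hW.symm hfr.differentiable hfr.lipschitz rfl ?_
      have := (hprox k).add_norm_sq_le hα0 (hcoe (hfin k)) (u := x k)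
        (fun t ht0 ht1 => ProxDGD.sumReg_convex_comb_le hfr.ne_bot hconv (hfin k) hk ht0 ht1)
      rw [norm_sub_rev (x k) (x (k + 1))] at this
      linarith
    · rw [lt_div_iff₀ hLf] at hstep
      refine ⟨(1 - 1 + ProxDGD.lambdaMin W - α * ProxDGD.maxLip L) / (2 * α),
        div_pos (by linarith) (by positivity), fun k hk => ?_⟩
      refine ProxDGD.lyapunov_sufficient_decrease hα0 hW.symm hfr.differentiable hfr.lipschitz rfl ?_
      have := (hprox k).real_le (hcoe (hfin k)) (hcoe hk)
      linarith
  obtain ⟨K, hK, hlip⟩ := ProxDGD.exists_lipschitz_lyapunovGrad (W := W) hα0 hLf.le hfr.lipschitz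
  -- `M = L_f / 2` suffices for the lower quadratic bound, since the form of `I - W` is nonnegative
  -- and can be dropped.
  refine ProxDGD.proximalGradient_rates (M := ProxDGD.maxLip L / 2) hα0 ha (by positivity) hK hc₁
    (ProxDGD.continuous_lyapunov hfr.differentiable) (fun y u => ?_) hlip hbot
    (hfr.lowerSemicontinuousAt_sumReg xs) hprox hdesc hxs hKL
  have h1 := (abs_le.1 (ProxDGD.lyapunov_taylor (α := α) hW.symm hfr.differentiable
    hfr.lipschitz y u)).1
  have h2 : 0 ≤ 1 / (2 * α) * inner ℝ (u - y) (ProxDGD.mix (1 - W) (u - y)) :=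
    mul_nonneg (by positivity) (ProxDGD.inner_mix_nonneg hW.le_one _)
  linarith
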